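/- **Notation.** Let $n\ge 5$, $L\ge 2$ be integers, $\varepsilon\ge 0$ a rational number, $\mathbf E\subseteq\mathbb N$, and $A_n$ an alphabet of $n$ letters. The period $\mathrm{per}(v)$ of a nonempty word $v$ is the least $p\ge1$ with $v(i)=v(i+p)$ whenever both positions exist. A word over $A_n$ is a *threshold word* if $|v|/\mathrm{per}(v)\le\frac n{n-1}$ for each of its nonempty factors $v$; a right-infinite word is a threshold word if all its finite factors are. Put $\chi(k)=0$ for $k\in\mathbf E$ and $\chi(k)=1$ otherwise. For $x\neq\lambda$ ($\lambda$ is the empty word) the word $xyx$ is called *$(|x|,e)$-exponential* if $\frac{|xyx|+e}{|xy|}\le\frac n{n-1}$. An *$(\varepsilon,\mathbf E)$-threshold word* is a threshold word in which every factor $xyx$ with $x\ne\lambda$, $|x|\notin\mathbf E$ is $(|x|,\varepsilon)$-exponential. **Systems of images.** For every letter $a$ let $\mathbf V_a\subseteq A_n^L$ be a nonempty set of words of length $L$ (images of $a$), $\mathbb V=\bigcup_a\mathbf V_a$, and for all $a\ne b$ and $v\in\mathbf V_a$ let $\delta_b(v)\subseteq\mathbf V_b$. Write $\Delta_n=\{\delta_a\}$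 and $\delta_-=\min\{|\delta_b(v)|: v\in\mathbf V_a,\ a\neq b\}$. Let $\mathsf{lcp}(u,v)$, $\mathsf{lcs}(u,v)$ be the lengths of the longest common prefix and suffix of $u,v$, and let $\mathsf{lcp}$, $\mathsf{lcs}$ be the maxima of these numbers over images $u,v$ of two different letters. A *substitution* $\phi$ on an $(\varepsilon,\mathbf E)$-threshold word $w$ is a choice of images $\phi_j(w)\in\mathbf V_{w[j]}$ ($1\le j\le|w|$) such that (M1) $\phi_j(w)\in\delta_{w[j]}(\phi_{j-1}(w))$ for $j>1$; (M2) if $xyx=w[i+1..i+r]$, $x\ne\lambda$, $|x|\in\mathbf E$, is not $(|x|,\varepsilon)$-exponential, then $\phi_m(w)\ne\phi_{m+|xy|}(w)$ for some $i<m\le i+|x|$. Its result is $\phi(w)=\phi_1(w)\cdots\phi_{|w|}(w)$. For words $x',y'$, let $\Delta(x',y')\in\mathbb N_0\cup\{\infty\}$ be the least $k\ge0$ such that for some $(\varepsilon,\mathbf E)$-threshold word $w$ and some substitution $\phi$ on it $|\phi(w)|=kL+|x'|+|y'|$, $x'$ is a prefix and $y'$ a suffix of $\phi(w)$ ($\infty$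 if there is none). **Consistency.** Below, a star $*$ stands for arbitrary, possibly different, possibly empty words. The gaps ($z,z_1,z_2$, and also $y,z$ in 2.1.2) may be empty; the pieces of the repeated word ($x$ in 2.1.0 and 2.1.2; $x,y$ in 2.1.1, 2.1.3, 2.2 and 2.3; $x,y,z$ in 3.2) are nonempty. An inequality containing $\Delta=\infty$ counts as true. $\Delta_n$ is *$(L,\varepsilon,\mathbf E)$-consistent* if for all $u_1\in\mathbf V_a$, $v_1\in\delta_b(u_1)$, $w_1\in\delta_e(v_1)$ with $a,b,e$ pairwise different, all $u_2\in\mathbf V_c$, $v_2\in\delta_d(u_2)$ with $c\ne d$, and all $u,v,w\in\mathbb V$: - (1.1) $\mathrm{per}(u)=L$. (1.2) No nonempty suffix of an image of a letter is a prefix of an image of a different letter. - (2.1.0) Every factor $xyx$ of $u$ is $(|x|,\varepsilon\chi(|x|))$-exponential. - (2.1.1) If $u_1=*xyzx$, $v_1=y*$, then $xyzxy$ is $(|xy|,\varepsilon\chi(|xy|))$-exponential. - (2.1.2) If $u=*xy$, $v=zx*$, $|x|<L$, then $\frac{\Delta(u,v)L+|xyzx|+\varepsilon\chi(|x|)}{\Delta(u,v)L+|xyz|}\le\frac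 n{n-1}$. - (2.1.3) If $u_1=*x$, $v_1=yzxy*$, then $xyzxy$ is $(|xy|,\varepsilon\chi(|xy|))$-exponential. - (2.2.1) If $u=*x$, $v=yz_1$, $w=z_2xy*$, where the letter of $v$ differs from those of $u$ and $w$, then $\frac{DL+|xyz_1z_2xy|+\varepsilon\chi(|xy|)}{DL+|xyz_1z_2|}\le\frac n{n-1}$ with $D=\Delta(uv,w)$. - (2.2.2) If $u_1=*x$, $v_1=yzx$, $w_1=y*$, then $xyzxy$ is $(|xy|,\varepsilon\chi(|xy|))$-exponential. - (2.2.3) If $u=*xyz_1$, $v=z_2x$, $w=y*$, where the letter of $v$ differs from those of $u$ and $w$, then the inequality of (2.2.1) holds with $D=\Delta(u,vw)$. - (2.3) If $u_1=*x$, $v_1=yz_1$, $u_2=z_2x$, $v_2=y*$, $a\neq c$, $b\neq d$, then the inequality of (2.2.1) holds with $D=\Delta(u_1v_1,u_2v_2)$. - (3.1) If $u_1\ne u_2$, then $\mathsf{lcp}(u_1,u_2)\le L-\mathsf{lcs}-\varepsilon$ and $\mathsf{lcs}(u_1,u_2)\le L-\mathsf{lcp}-\varepsilon$. - (3.2) If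 $u_1=*x$, $v_1=yz*$, $u_2=*xy$, $v_2=z*$, then $\frac{L(n-2)+|y|+|xyz|+\varepsilon\chi(|xyz|)}{L(n-2)+|y|}\le\frac n{n-1}$. **Statement.** Assume that $\Delta_n$ is $(L,\varepsilon,\mathbf E)$-consistent, $\varepsilon(L-1)=\mathsf{lcs}+\mathsf{lcp}$ and $\delta_->|\mathbf E|$. Then: (1) there is an infinite threshold word over $n$ letters; (2) if moreover $\varepsilon\le\frac1{n-1}$, the number of threshold words over $n$ letters grows exponentially: there are $C>0$ and $\gamma>1$ such that for every $m\ge0$ there are at least $C\gamma^m$ threshold words of length $m$ over $n$ letters. -/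

import Mathlib

/-!
Words over the alphabet `Fin n` are lists. A word `x ++ y ++ x` is a repetition with root `x ++ y`
and repeated part `x`.
-/

namespace ThresholdWords

/-- The period of a word: the least `p ≥ 1` with `w(i) = w(i + p)` whenever both
positions exist.
(For a nonempty word this is at most its length.) -/
noncomputable def period {n : ℕ} (w : List (Fin n)) : ℕ :=
  sInf {p : ℕ | 0 < p ∧ w.HasPeriod p}

/-- Threshold words over `n ≥ 5` letters: every nonempty factor has exponent at most `n/(n-1)`. -/
def IsThreshold {n : ℕ} (w : List (Fin n)) : Prop :=
  ∀ v : List (Fin n), v ≠ [] → v <:+: w →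
    (v.length : ℚ) / (period v : ℚ) ≤ (n : ℚ) / ((n : ℚ) - 1)

/-- A right-infinite threshold word: all finite factors are threshold words. -/
def IsInfiniteThreshold {n : ℕ} (f : ℕ → Fin n) : Prop :=
  ∀ i k : ℕ, IsThreshold ((List.range k).map fun j => f (i + j))

/-- The number of threshold words of length `m` over `n` letters. -/
noncomputable def thresholdCount (n m : ℕ) : ℕ :=
  Set.ncard {w : List (Fin n) | w.length = m ∧ IsThreshold w}

/-- A repetition whose root has length `g` and whose repeated part has length `r` satisfies
`(g + r + e) / g ≤ n/(n-1)`. -/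
def ExpBound (n g r : ℕ) (e : ℚ) : Prop :=
  ((g : ℚ) + (r : ℚ) + e) / (g : ℚ) ≤ (n : ℚ) / ((n : ℚ) - 1)

/-- `x ++ y ++ x` is `(|x|, e)`-exponential. -/
def IsExponential {n : ℕ} (x y : List (Fin n)) (e : ℚ) : Prop :=
  ExpBound n (x ++ y).length x.length e

/-- The characteristic function of the complement of `E`. -/
noncomputable def chi (E : Set ℕ) (k : ℕ) : ℚ := Set.indicator Eᶜ (fun _ => (1 : ℚ)) k

/-- `(ε, E)`-threshold words. -/
def IsEpsThreshold {n : ℕ} (ε : ℚ) (E : Set ℕ) (w : List (Fin n)) : Prop :=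
  IsThreshold w ∧ ∀ x y : List (Fin n), x ≠ [] → x ++ y ++ x <:+: w →
    x.length ∉ E → IsExponential x y ε

/-- Length of the longest common prefix. -/
noncomputable def lcp {n : ℕ} (u v : List (Fin n)) : ℕ :=
  sSup {k : ℕ | ∃ x : List (Fin n), x <+: u ∧ x <+: v ∧ x.length = k}

/-- Length of the longest common suffix. -/
noncomputable def lcs {n : ℕ} (u v : List (Fin n)) : ℕ :=
  sSup {k : ℕ | ∃ x : List (Fin n), x <:+ u ∧ x <:+ v ∧ x.length = k}

/-- For every letter `a` a nonempty set `V a` of words of length `L` (the possible images of `a`),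
together with the functions `δ b`, which send an image `v` of a letter `a ≠ b` to the set of images
of `b` that are allowed to follow `v` immediately. -/
structure ImageSystem (n L : ℕ) where
  V : Fin n → Finset (List (Fin n))
  V_nonempty : ∀ a, (V a).Nonempty
  V_length : ∀ a, ∀ u ∈ V a, u.length = L
  δ : Fin n → List (Fin n) → Finset (List (Fin n))
  δ_subset : ∀ a b, a ≠ b → ∀ v ∈ V a, δ b v ⊆ V b

namespace ImageSystem

variable {n L : ℕ} (S : ImageSystem n L)

/-- `δ₋`, the least number of images of a letter `b` allowed after an image of a letter `a ≠ b`. -/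
noncomputable def deltaMin : ℕ :=
  sInf {k : ℕ | ∃ a b, a ≠ b ∧ ∃ v ∈ S.V a, k = (S.δ b v).card}

/-- The longest common prefix of images of two different letters. -/
noncomputable def lcpV : ℕ :=
  sSup {k : ℕ | ∃ a b, a ≠ b ∧ ∃ u ∈ S.V a, ∃ v ∈ S.V b, k = lcp u v}

/-- The longest common suffix of images of two different letters. -/
noncomputable def lcsV : ℕ :=
  sSup {k : ℕ | ∃ a b, a ≠ b ∧ ∃ u ∈ S.V a, ∃ v ∈ S.V b, k = lcs u v}

/-- `ψ` is the list of the letter images `φ₁(w), φ₂(w), …` of an `(L, ε, E, Δ)`-substitution `φ`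
applied to `w`; the word `φ(w)` itself is `ψ.flatten`. -/
structure IsSubstitution (ε : ℚ) (E : Set ℕ) (w : List (Fin n)) (ψ : List (List (Fin n))) :
    Prop where
  length_eq : ψ.length = w.length
  mem_V : ∀ (i : ℕ) (a : Fin n) (u : List (Fin n)),
    w[i]? = some a → ψ[i]? = some u → u ∈ S.V a
  /-- each image is allowed after the preceding one -/
  follows : ∀ (j : ℕ) (a : Fin n) (u v : List (Fin n)),
    w[j + 1]? = some a → ψ[j]? = some u → ψ[j + 1]? = some v → v ∈ S.δ a u
  /-- the two occurrences of the repeated part of a critical repetition get different images -/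
  splits : ∀ l x y r : List (Fin n), w = l ++ (x ++ y ++ x) ++ r → x ≠ [] → x.length ∈ E →
    ¬ IsExponential x y ε →
    ∃ m < x.length, ψ[l.length + m]? ≠ ψ[l.length + m + (x ++ y).length]?

/-- The distance `Δ(x', y')`: the least `k` such that, for some `(ε, E)`-threshold word `w` and some
substitution, the image of `w` has prefix `x'` and suffix `y'`, with the images of exactly `k`
letters of `w` between them; `⊤` if there is no such `k`. -/
noncomputable def gap (ε : ℚ) (E : Set ℕ) (x' y' : List (Fin n)) : ℕ∞ :=
  ⨅ k ∈ {k : ℕ | ∃ (w : List (Fin n)) (ψ : List (List (Fin n))),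
      IsEpsThreshold ε E w ∧ S.IsSubstitution ε E w ψ ∧
      L * w.length = L * k + x'.length + y'.length ∧
      x' <+: ψ.flatten ∧ y' <:+ ψ.flatten}, (k : ℕ∞)

/-- The bound `(d L + g + r + ε χ(r)) / (d L + g) ≤ n/(n-1)`; no condition if `d = ⊤`. -/
def GapBound (n L : ℕ) (ε : ℚ) (E : Set ℕ) (d : ℕ∞) (g r : ℕ) : Prop :=
  ∀ k : ℕ, d = (k : ℕ∞) → ExpBound n (k * L + g) r (ε * chi E r)

/-- `(L, ε, E)`-consistent systems. The words `α`, `β`, … are arbitrary, possibly empty, remainders;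
so are the pieces of a root that lie between the two occurrences of the repeated part. The pieces
into which the repeated part is cut by the boundaries of the images are nonempty. -/
structure Consistent (ε : ℚ) (E : Set ℕ) : Prop where
  uf11 : ∀ a, ∀ u ∈ S.V a, period u = L
  uf12 : ∀ a b, a ≠ b → ∀ u ∈ S.V a, ∀ v ∈ S.V b, ∀ x : List (Fin n), x ≠ [] →
    x <:+ u → ¬ x <+: v
  /-- repetitions inside one image -/
  uf210 : ∀ a, ∀ u ∈ S.V a, ∀ x y : List (Fin n), x ≠ [] → x ++ y ++ x <:+: u →
    IsExponential x y (ε * chi E x.length)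
  uf211 : ∀ a b, a ≠ b → ∀ u₁ ∈ S.V a, ∀ v₁ ∈ S.δ b u₁, ∀ α β x y z : List (Fin n),
    x ≠ [] → y ≠ [] → u₁ = α ++ x ++ y ++ z ++ x → v₁ = y ++ β →
    IsExponential (x ++ y) z (ε * chi E (x ++ y).length)
  /-- `a = b` is allowed; the repeated part is a proper factor of the images -/
  uf212 : ∀ a b, ∀ u ∈ S.V a, ∀ v ∈ S.V b, ∀ α β x y z : List (Fin n),
    x ≠ [] → x.length < L → u = α ++ x ++ y → v = z ++ x ++ β →
    GapBound n L ε E (S.gap ε E u v) (x ++ y ++ z).length x.length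
  uf213 : ∀ a b, a ≠ b → ∀ u₁ ∈ S.V a, ∀ v₁ ∈ S.δ b u₁, ∀ α β x y z : List (Fin n),
    x ≠ [] → y ≠ [] → u₁ = α ++ x → v₁ = y ++ z ++ x ++ y ++ β →
    IsExponential (x ++ y) z (ε * chi E (x ++ y).length)
  /-- the first and the third image may belong to the same letter -/
  uf221 : ∀ a b c, a ≠ b → b ≠ c → ∀ u ∈ S.V a, ∀ v ∈ S.V b, ∀ w ∈ S.V c,
    ∀ α β x y z₁ z₂ : List (Fin n), x ≠ [] → y ≠ [] →
    u = α ++ x → v = y ++ z₁ → w = z₂ ++ x ++ y ++ β →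
    GapBound n L ε E (S.gap ε E (u ++ v) w) (x ++ y ++ z₁ ++ z₂).length (x ++ y).length
  uf222 : ∀ a b e, a ≠ b → b ≠ e → e ≠ a →
    ∀ u₁ ∈ S.V a, ∀ v₁ ∈ S.δ b u₁, ∀ w₁ ∈ S.δ e v₁, ∀ α β x y z : List (Fin n),
    x ≠ [] → y ≠ [] → u₁ = α ++ x → v₁ = y ++ z ++ x → w₁ = y ++ β →
    IsExponential (x ++ y) z (ε * chi E (x ++ y).length)
  /-- the first and the third image may belong to the same letter -/
  uf223 : ∀ a b c, a ≠ b → b ≠ c → ∀ u ∈ S.V a, ∀ v ∈ S.V b, ∀ w ∈ S.V c,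
    ∀ α β x y z₁ z₂ : List (Fin n), x ≠ [] → y ≠ [] →
    u = α ++ x ++ y ++ z₁ → v = z₂ ++ x → w = y ++ β →
    GapBound n L ε E (S.gap ε E u (v ++ w)) (x ++ y ++ z₁ ++ z₂).length (x ++ y).length
  /-- `u₁`, `u₂` are images of different letters, and so are `v₁`, `v₂` -/
  uf23 : ∀ a b c d, a ≠ b → c ≠ d → a ≠ c → b ≠ d →
    ∀ u₁ ∈ S.V a, ∀ v₁ ∈ S.δ b u₁, ∀ u₂ ∈ S.V c, ∀ v₂ ∈ S.δ d u₂,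
    ∀ α β x y z₁ z₂ : List (Fin n), x ≠ [] → y ≠ [] →
    u₁ = α ++ x → v₁ = y ++ z₁ → u₂ = z₂ ++ x → v₂ = y ++ β →
    GapBound n L ε E (S.gap ε E (u₁ ++ v₁) (u₂ ++ v₂))
      (x ++ y ++ z₁ ++ z₂).length (x ++ y).length
  uf31 : ∀ a c, ∀ u₁ ∈ S.V a, ∀ u₂ ∈ S.V c, u₁ ≠ u₂ →
    (lcp u₁ u₂ : ℚ) ≤ (L : ℚ) - S.lcsV - ε ∧ (lcs u₁ u₂ : ℚ) ≤ (L : ℚ) - S.lcpV - ε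
  /-- equal letters of a threshold word are separated by at least `n - 2` letters, so the root of
  the repetition below has length at least `L (n - 2) + |y|` -/
  uf32 : ∀ a b c d, a ≠ b → c ≠ d →
    ∀ u₁ ∈ S.V a, ∀ v₁ ∈ S.δ b u₁, ∀ u₂ ∈ S.V c, ∀ v₂ ∈ S.δ d u₂,
    ∀ α β α' β' x y z : List (Fin n), x ≠ [] → y ≠ [] → z ≠ [] →
    u₁ = α ++ x → v₁ = y ++ z ++ β → u₂ = α' ++ x ++ y → v₂ = z ++ β' →
    ExpBound n (L * (n - 2) + y.length) (x ++ y ++ z).length (ε * chi E (x ++ y ++ z).length)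

end ImageSystem

end ThresholdWords

/-! The core is that a substitution sends an (ε, E)-threshold word to an (ε, E)-threshold word
(`good_image`). Repetitions in the image are sorted by the length p of their root.

If L does not divide p, neither occurrence of the repeated part contains a whole image: (1.2),
together with the fact that adjacent letters differ, forces images to occur only at block boundaries
(`dvd_of_seg_eq`). So each occurrence meets at most two images, and the consistency conditions
settle the finitely many relative positions (`repBound_of_not_dvd`).

If p = kL, extend the repetition as far as possible. Its repeated part consists of a suffix of
length s, m whole images and a prefix of length t, and the whole images come from a repetition with
root k in the preimage. If m ≥ 1 and the letters at both ends differ, then s + t ≤ lcs + lcp = ε(L -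
1), so r + ε ≤ (m + ε)L and the bound (n - 1)(m + ε) ≤ k scales by L. For m in E this bound may fail
in the preimage, but then (M2) would have given the two occurrences different images. If an end has
equal letters with different images, the preimage repetition is longer, and (3.1) leaves enough room
(`repBound_of_dvd`).

Substitutions exist because, building from left to right, (M2) forbids at most one image for each
length in E (`IsCritical.unique`), and δ₋ > |E|. Iteration gives arbitrarily long words and
compactness an infinite one. For growth, 1 must lie in E (`one_mem`). If ε ≤ 1/(n - 1), critical
repetitions of single letters cannot end at two consecutive positions, so one of any two consecutive
images can be chosen in two ways. Distinct choices give distinct words. -/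

namespace ThresholdWords

/-! ### Factors of infinite words -/

/-- The factor of length `r` of the infinite word `f` that starts at position `i`. -/
def seg {α : Type*} (f : ℕ → α) (i r : ℕ) : List α := (List.range r).map fun j => f (i + j)

/-- The factors of length `r` of `f` at the positions `i` and `i + p` coincide. -/
def RepAt {α : Type*} (f : ℕ → α) (i p r : ℕ) : Prop := ∀ t < r, f (i + t) = f (i + t + p)

@[simp] theorem length_seg {α : Type*} (f : ℕ → α) (i r : ℕ) : (seg f i r).length = r := by
  simp [seg]

theorem getElem?_seg {α : Type*} (f : ℕ → α) {i r j : ℕ} (h : j < r) :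
    (seg f i r)[j]? = some (f (i + j)) := by
  simp [seg, h]

theorem getElem?_seg_eq_some {α : Type*} {f : ℕ → α} {i r j : ℕ} {a : α}
    (h : (seg f i r)[j]? = some a) : j < r ∧ a = f (i + j) := by
  have hj : j < r := by
    have := (List.getElem?_eq_some_iff.1 h).1
    simpa using this
  rw [getElem?_seg f hj] at h
  exact ⟨hj, (Option.some.inj h).symm⟩

theorem seg_add {α : Type*} (f : ℕ → α) (i a b : ℕ) :
    seg f i (a + b) = seg f i a ++ seg f (i + a) b := by
  simp [seg, List.range_add, List.map_map, Function.comp_def, Nat.add_assoc]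

theorem seg_split {α : Type*} (f : ℕ → α) {i j a b c : ℕ} (hj : j = i + a) (hc : c = a + b) :
    seg f i c = seg f i a ++ seg f j b := by
  subst hj hc; exact seg_add f i a b

theorem seg_congr {α : Type*} {f g : ℕ → α} {i j r : ℕ} (h : ∀ t < r, f (i + t) = g (j + t)) :
    seg f i r = seg g j r := by
  simp only [seg]
  exact List.map_congr_left fun t ht => h t (List.mem_range.1 ht)

theorem eq_of_seg_eq {α : Type*} {f g : ℕ → α} {i j r : ℕ} (h : seg f i r = seg g j r) {t : ℕ}
    (ht : t < r) : f (i + t) = g (j + t) := by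
  have := congrArg (fun l => l[t]?) h
  simp only [getElem?_seg _ ht] at this
  exact Option.some.inj this

theorem seg_ne_nil {α : Type*} (f : ℕ → α) (i : ℕ) {r : ℕ} (h : 0 < r) : seg f i r ≠ [] := by
  intro h'
  have := congrArg List.length h'
  simp at this
  omega

theorem seg_prefix {α : Type*} (f : ℕ → α) (i : ℕ) {a c : ℕ} (h : a ≤ c) :
    seg f i a <+: seg f i c :=
  ⟨seg f (i + a) (c - a), (seg_split f rfl (by omega)).symm⟩

theorem seg_suffix {α : Type*} (f : ℕ → α) {i j b c : ℕ} (h : i + c = j + b) (hb : b ≤ c) :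
    seg f j b <:+ seg f i c :=
  ⟨seg f i (c - b), (seg_split f (by omega) (by omega)).symm⟩

theorem seg_infix {α : Type*} (f : ℕ → α) {i j b c : ℕ} (h : i ≤ j) (hb : j + b ≤ i + c) :
    seg f j b <:+: seg f i c := by
  refine ⟨seg f i (j - i), seg f (j + b) (i + c - (j + b)), ?_⟩
  rw [← seg_split f (c := j - i + b) (by omega) rfl, ← seg_split f (c := c) (by omega) (by omega)]

theorem eq_seg_of_append_eq {α : Type*} {f : ℕ → α} {i c : ℕ} {s v t : List α}
    (h : s ++ v ++ t = seg f i c) : v = seg f (i + s.length) v.length ∧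
      s.length + v.length + t.length = c := by
  have hlen : s.length + v.length + t.length = c := by
    have := congrArg List.length h
    simp at this; omega
  refine ⟨?_, hlen⟩
  apply List.ext_getElem?
  intro j
  by_cases hj : j < v.length
  · rw [getElem?_seg f hj]
    have h1 := congrArg (fun l => l[s.length + j]?) h
    simp only [List.append_assoc] at h1
    rw [List.getElem?_append_right (by omega), Nat.add_sub_cancel_left,
      List.getElem?_append_left hj, getElem?_seg f (by omega)] at h1
    rw [h1, Nat.add_assoc]
  · rw [List.getElem?_eq_none (by omega), List.getElem?_eq_none (by simp; omega)]

theorem RepAt.mono {α : Type*} {f : ℕ → α} {i p r r' : ℕ} (h : RepAt f i p r) (hr : r' ≤ r) :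
    RepAt f i p r' := fun t ht => h t (by omega)

theorem RepAt.seg_eq {α : Type*} {f : ℕ → α} {i p r a b c : ℕ} (h : RepAt f i p r)
    (ha : i ≤ a) (hb : b = a + p) (hc : a + c ≤ i + r) : seg f b c = seg f a c := by
  subst hb
  refine seg_congr fun t ht => ?_
  have := h (a - i + t) (by omega)
  rw [show i + (a - i + t) = a + t by omega] at this
  rw [this]; congr 1; omega

theorem repAt_of_seg_eq {α : Type*} {f : ℕ → α} {i p r : ℕ} (h : seg f i r = seg f (i + p) r) :
    RepAt f i p r := by
  intro t ht
  rw [eq_of_seg_eq h ht]; congr 1; omega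

theorem flatten_seg {α : Type*} {ψ : ℕ → List α} {f : ℕ → α} {L i k : ℕ}
    (h : ∀ q, i ≤ q → q < i + k → ψ q = seg f (q * L) L) :
    (seg ψ i k).flatten = seg f (i * L) (k * L) := by
  induction k with
  | zero => simp [seg]
  | succ k ih =>
    rw [seg_add, List.flatten_append, ih fun q h1 h2 => h q h1 (by omega), Nat.succ_mul, seg_add,
      ← Nat.add_mul]
    congr 1
    simpa [seg] using h (i + k) (by omega) (by omega)

/-! ### The exponent bound in product form -/

section Bounds

variable {n : ℕ} {ε : ℚ} {E : Set ℕ}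

theorem chi_nonneg (E : Set ℕ) (k : ℕ) : 0 ≤ chi E k := by
  unfold chi; exact Set.indicator_nonneg (fun _ _ => zero_le_one) k

theorem chi_le_one (E : Set ℕ) (k : ℕ) : chi E k ≤ 1 := by
  unfold chi; exact Set.indicator_le_self' (fun _ _ => zero_le_one) k

theorem chi_of_notMem {E : Set ℕ} {k : ℕ} (h : k ∉ E) : chi E k = 1 := by
  simp [chi, h]

/-- A repetition with root of length `p` and repeated part of length `r` is as long as an
`(ε, E)`-threshold word allows. -/
def RepBound (n : ℕ) (ε : ℚ) (E : Set ℕ) (p r : ℕ) : Prop :=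
  ((n : ℚ) - 1) * (r + ε * chi E r) ≤ p

theorem expBound_iff (hn : 5 ≤ n) {p r : ℕ} (hp : 0 < p) (e : ℚ) :
    ExpBound n p r e ↔ ((n : ℚ) - 1) * (r + e) ≤ p := by
  have h1 : (5 : ℚ) ≤ n := by exact_mod_cast hn
  have h2 : (0 : ℚ) < p := by exact_mod_cast hp
  unfold ExpBound
  rw [div_le_div_iff₀ h2 (by linarith)]
  constructor <;> intro h <;> nlinarith

theorem RepBound.of_expBound (hn : 5 ≤ n) {p p' r : ℕ} (hp : 0 < p) (hpp : p ≤ p')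
    (h : ExpBound n p r (ε * chi E r)) : RepBound n ε E p' r := by
  have h3 : (p : ℚ) ≤ p' := by exact_mod_cast hpp
  exact ((expBound_iff hn hp _).1 h).trans h3

theorem RepBound.of_le (hn : 5 ≤ n) (hε : 0 ≤ ε) {p r : ℕ}
    (h : ((n : ℚ) - 1) * (r + ε) ≤ p) : RepBound n ε E p r := by
  have h1 : (5 : ℚ) ≤ n := by exact_mod_cast hn
  have := chi_le_one E r
  have h3 : ε * chi E r ≤ ε := by nlinarith
  unfold RepBound
  nlinarith

theorem RepBound.mul_le (hn : 5 ≤ n) (hε : 0 ≤ ε) {p r : ℕ} (h : RepBound n ε E p r) :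
    (n - 1) * r ≤ p := by
  have h1 : (5 : ℚ) ≤ n := by exact_mod_cast hn
  have h2 : 0 ≤ ε * chi E r := mul_nonneg hε (chi_nonneg E r)
  unfold RepBound at h
  have h3 : ((n - 1 : ℕ) : ℚ) * r ≤ p := by
    rw [Nat.cast_sub (by omega)]; push_cast; nlinarith
  exact_mod_cast h3

/-- Shortening the repeated part can move its length out of E and switch the ε-term on; the lost
letter pays for it because ε ≤ 1. -/
theorem RepBound.of_succ (hn : 5 ≤ n) (hε : 0 ≤ ε) (hε1 : ε ≤ 1) {p r : ℕ}
    (h : RepBound n ε E p (r + 1)) : RepBound n ε E p r := by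
  have h1 : (5 : ℚ) ≤ n := by exact_mod_cast hn
  have h2 : 0 ≤ ε * chi E (r + 1) := mul_nonneg hε (chi_nonneg E _)
  refine .of_le hn hε ?_
  unfold RepBound at h
  push_cast at h
  nlinarith

/-- Every repetition in the first `N` letters of `f` obeys the bound. -/
def Good (ε : ℚ) (E : Set ℕ) (f : ℕ → Fin n) (N : ℕ) : Prop :=
  ∀ i p r, 0 < p → 0 < r → i + p + r ≤ N → RepAt f i p r → RepBound n ε E p r

theorem Good.mono {f : ℕ → Fin n} {N N' : ℕ} (h : Good ε E f N) (hN : N' ≤ N) :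
    Good ε E f N' := fun i p r hp hr hi => h i p r hp hr (by omega)

/-- A factor of length l with period p < l is a repetition with root p and repeated part l - p;
otherwise its exponent is at most 1. -/
theorem Good.isThreshold (hn : 5 ≤ n) (hε : 0 ≤ ε) {f : ℕ → Fin n} {N i k : ℕ}
    (h : Good ε E f N) (hk : i + k ≤ N) : IsThreshold (seg f i k) := by
  have h1 : (5 : ℚ) ≤ n := by exact_mod_cast hn
  intro v hv ⟨s, t, hst⟩
  obtain ⟨hseg, hlen⟩ := eq_seg_of_append_eq hst
  set l := v.length with hl
  have hl0 : 0 < l := List.length_pos_iff.2 hv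
  have hmem : period v ∈ {p : ℕ | 0 < p ∧ v.HasPeriod p} :=
    Nat.sInf_mem ⟨l, hl0, v.hasPeriod_of_length_le l le_rfl⟩
  obtain ⟨hp, hper⟩ := hmem
  set p := period v
  have hp' : (0 : ℚ) < p := by exact_mod_cast hp
  rw [div_le_div_iff₀ hp' (by linarith)]
  rcases Nat.lt_or_ge p l with hpl | hpl
  · have hb := (h (i + s.length) p (l - p) hp (by omega) (by omega) ?_).mul_le hn hε
    · have h2 : ((n - 1 : ℕ) : ℚ) * ((l - p : ℕ) : ℚ) ≤ p := by exact_mod_cast hb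
      rw [Nat.cast_sub (by omega), Nat.cast_sub hpl.le] at h2
      push_cast at h2
      linarith
    · intro t ht
      have h2 := List.hasPeriod_iff_getElem?.1 hper t ht
      rw [hseg, getElem?_seg f (by omega), getElem?_seg f (by omega)] at h2
      simpa [Nat.add_assoc] using h2
  · have h2 : (l : ℚ) ≤ p := by exact_mod_cast hpl
    nlinarith

theorem Good.isEpsThreshold (hn : 5 ≤ n) (hε : 0 ≤ ε) {f : ℕ → Fin n} {N i k : ℕ}
    (h : Good ε E f N) (hk : i + k ≤ N) : IsEpsThreshold ε E (seg f i k) := by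
  refine ⟨h.isThreshold hn hε hk, fun x y hx ⟨s, t, hst⟩ hxE => ?_⟩
  have hx0 : 0 < x.length := List.length_pos_iff.2 hx
  have h1 : s ++ x ++ (y ++ x ++ t) = seg f i k := by simpa using hst
  have h2 : (s ++ x ++ y) ++ x ++ t = seg f i k := by simpa using hst
  obtain ⟨e1, l1⟩ := eq_seg_of_append_eq h1
  obtain ⟨e2, l2⟩ := eq_seg_of_append_eq h2
  simp only [List.length_append] at l1 e2
  have hb := h (i + s.length) (x ++ y).length x.length (by simp; omega) hx0 (by simp; omega) ?_
  · unfold IsExponential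
    rw [expBound_iff hn (by simp; omega)]
    unfold RepBound at hb
    rwa [chi_of_notMem hxE, mul_one] at hb
  · apply repAt_of_seg_eq
    rw [← e1]
    conv_lhs => rw [e2]
    congr 1
    simp; omega

/-- Two equal letters form a repetition with a repeated part of length 1. -/
theorem Good.dist (hn : 5 ≤ n) (hε : 0 ≤ ε) {f : ℕ → Fin n} {N q q' : ℕ} (h : Good ε E f N)
    (hq : q < q') (hq' : q' < N) (he : f q = f q') : n - 1 ≤ q' - q := by
  have := (h q (q' - q) 1 (by omega) one_pos (by omega) ?_).mul_le hn hε
  · simpa using this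
  · intro t ht
    obtain rfl : t = 0 := by omega
    rw [add_zero, he]; congr 1; omega

end Bounds

/-! ### Substitutions and the distance Δ -/

namespace ImageSystem

variable {n L : ℕ} (S : ImageSystem n L)

/-- `ψ` is a choice of images of the first `N` letters of `g`, as in `IsSubstitution`. -/
structure IsSubst (ε : ℚ) (E : Set ℕ) (g : ℕ → Fin n) (ψ : ℕ → List (Fin n)) (N : ℕ) : Prop where
  mem : ∀ q < N, ψ q ∈ S.V (g q)
  follows : ∀ q, q + 1 < N → ψ (q + 1) ∈ S.δ (g (q + 1)) (ψ q)
  splits : ∀ i p r, 0 < p → 0 < r → i + p + r ≤ N → RepAt g i p r → r ∈ E →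
    ¬ ((n : ℚ) - 1) * (r + ε) ≤ p → ∃ m < r, ψ (i + m) ≠ ψ (i + m + p)

variable {S} {ε : ℚ} {E : Set ℕ} {g : ℕ → Fin n} {ψ : ℕ → List (Fin n)} {N : ℕ}

theorem IsSubst.isSubstitution (hn : 5 ≤ n) (h : S.IsSubst ε E g ψ N) {i k : ℕ}
    (hk : i + k ≤ N) : S.IsSubstitution ε E (seg g i k) (seg ψ i k) where
  length_eq := by simp
  mem_V := by
    intro j a u ha hu
    obtain ⟨h1, rfl⟩ := getElem?_seg_eq_some ha
    obtain ⟨-, rfl⟩ := getElem?_seg_eq_some hu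
    exact h.mem _ (by omega)
  follows := by
    intro j a u v ha hu hv
    obtain ⟨h1, rfl⟩ := getElem?_seg_eq_some ha
    obtain ⟨-, rfl⟩ := getElem?_seg_eq_some hu
    obtain ⟨-, rfl⟩ := getElem?_seg_eq_some hv
    exact h.follows (i + j) (by omega)
  splits := by
    intro l x y r hw hx hxE hexp
    have hx0 : 0 < x.length := List.length_pos_iff.2 hx
    have h1 : l ++ x ++ (y ++ x ++ r) = seg g i k := by simpa using hw.symm
    have h2 : (l ++ x ++ y) ++ x ++ r = seg g i k := by simpa using hw.symm
    obtain ⟨e1, l1⟩ := eq_seg_of_append_eq h1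
    obtain ⟨e2, l2⟩ := eq_seg_of_append_eq h2
    simp only [List.length_append] at l1 e2
    unfold IsExponential at hexp
    rw [expBound_iff hn (by simp; omega)] at hexp
    have hrep : RepAt g (i + l.length) (x ++ y).length x.length := by
      apply repAt_of_seg_eq
      rw [← e1]
      conv_lhs => rw [e2]
      congr 1
      simp; omega
    obtain ⟨m, hm, hne⟩ := h.splits (i + l.length) (x ++ y).length x.length (by simp; omega) hx0
      (by simp; omega) hrep hxE hexp
    refine ⟨m, hm, ?_⟩
    rw [getElem?_seg ψ (by omega), getElem?_seg ψ (by simp; omega)]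
    intro h3
    apply hne
    have := Option.some.inj h3
    simpa only [Nat.add_assoc] using this

/-- The factor of `g` under these blocks, with its images, is itself a witness for the distance. -/
theorem gap_le (hn : 5 ≤ n) (hε : 0 ≤ ε) (hg : Good ε E g N) (h : S.IsSubst ε E g ψ N)
    {f : ℕ → Fin n} (hf : ∀ q < N, ψ q = seg f (q * L) L) {i c k c' : ℕ}
    (hN : i + c + k + c' ≤ N) :
    S.gap ε E (seg f (i * L) (c * L)) (seg f ((i + c + k) * L) (c' * L)) ≤ k := by
  refine iInf₂_le k ⟨seg g i (c + k + c'), seg ψ i (c + k + c'),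
    hg.isEpsThreshold hn hε (by omega), h.isSubstitution hn (by omega), ?_, ?_, ?_⟩
  · simp; ring
  · rw [flatten_seg fun q _ h2 => hf q (by omega)]
    exact seg_prefix f _ (Nat.mul_le_mul_right L (by omega))
  · rw [flatten_seg fun q _ h2 => hf q (by omega)]
    exact seg_suffix f (by ring) (Nat.mul_le_mul_right L (by omega))

/-- The actual number k of images in between is at least the distance, so the actual root is at
least as long as the one in the condition. Finiteness of the distance comes from `hd`. -/
theorem GapBound.repBound (hn : 5 ≤ n) {d : ℕ∞} {k b r p : ℕ} (h : GapBound n L ε E d b r)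
    (hd : d ≤ k) (hb : 0 < b) (hp : p = k * L + b) : RepBound n ε E p r := by
  obtain ⟨m, rfl⟩ := ENat.ne_top_iff_exists.1 (ne_top_of_le_ne_top (ENat.natCast_ne_top k) hd)
  have hm : m ≤ k := by exact_mod_cast hd
  refine .of_expBound hn (by omega) ?_ (h m rfl)
  have := Nat.mul_le_mul_right L hm
  omega

end ImageSystem

theorem seg_split3 {α : Type*} (f : ℕ → α) {i j k a b c d : ℕ} (hj : j = i + a) (hk : k = j + b)
    (hd : d = a + b + c) : seg f i d = seg f i a ++ seg f j b ++ seg f k c := by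
  rw [← seg_split f hj (c := a + b) rfl, ← seg_split f (by omega) hd]

theorem seg_split4 {α : Type*} (f : ℕ → α) {i j k l a b c d e : ℕ} (hj : j = i + a)
    (hk : k = j + b) (hl : l = k + c) (he : e = a + b + c + d) :
    seg f i e = seg f i a ++ seg f j b ++ seg f k c ++ seg f l d := by
  rw [← seg_split3 f hj hk (d := a + b + c) rfl, ← seg_split f (by omega) he]

theorem seg_split5 {α : Type*} (f : ℕ → α) {i j k l m a b c d e s : ℕ} (hj : j = i + a)
    (hk : k = j + b) (hl : l = k + c) (hm : m = l + d) (hs : s = a + b + c + d + e) :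
    seg f i s = seg f i a ++ seg f j b ++ seg f k c ++ seg f l d ++ seg f m e := by
  rw [← seg_split4 f hj hk hl (e := a + b + c + d) rfl, ← seg_split f (by omega) hs]

/-! ### Common prefixes and suffixes -/

section CommonPrefix

variable {n : ℕ}

theorem bddAbove_commonPrefix (u v : List (Fin n)) :
    BddAbove {k : ℕ | ∃ x : List (Fin n), x <+: u ∧ x <+: v ∧ x.length = k} :=
  ⟨u.length, by rintro _ ⟨x, h, -, rfl⟩; exact h.length_le⟩

theorem bddAbove_commonSuffix (u v : List (Fin n)) :
    BddAbove {k : ℕ | ∃ x : List (Fin n), x <:+ u ∧ x <:+ v ∧ x.length = k} :=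
  ⟨u.length, by rintro _ ⟨x, h, -, rfl⟩; exact h.length_le⟩

theorem length_le_lcp {u v x : List (Fin n)} (hu : x <+: u) (hv : x <+: v) :
    x.length ≤ lcp u v := le_csSup (bddAbove_commonPrefix u v) ⟨x, hu, hv, rfl⟩

theorem length_le_lcs {u v x : List (Fin n)} (hu : x <:+ u) (hv : x <:+ v) :
    x.length ≤ lcs u v := le_csSup (bddAbove_commonSuffix u v) ⟨x, hu, hv, rfl⟩

theorem lcp_le_length (u v : List (Fin n)) : lcp u v ≤ u.length :=
  csSup_le ⟨0, [], by simp⟩ (by rintro _ ⟨x, h, -, rfl⟩; exact h.length_le)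

theorem lcs_le_length (u v : List (Fin n)) : lcs u v ≤ u.length :=
  csSup_le ⟨0, [], by simp⟩ (by rintro _ ⟨x, h, -, rfl⟩; exact h.length_le)

end CommonPrefix

/-! ### Consequences of consistency for the parameters -/

namespace ImageSystem

variable {n L : ℕ} {S : ImageSystem n L} {ε : ℚ} {E : Set ℕ}

theorem bddAbove_lcpV : BddAbove {k : ℕ | ∃ a b, a ≠ b ∧ ∃ u ∈ S.V a, ∃ v ∈ S.V b, k = lcp u v} :=
  ⟨L, by
    rintro _ ⟨a, b, -, u, hu, v, -, rfl⟩
    exact (lcp_le_length u v).trans (S.V_length a u hu).le⟩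

theorem lcp_le_lcpV {a b : Fin n} (hab : a ≠ b) {u v : List (Fin n)} (hu : u ∈ S.V a)
    (hv : v ∈ S.V b) : lcp u v ≤ S.lcpV :=
  le_csSup bddAbove_lcpV ⟨a, b, hab, u, hu, v, hv, rfl⟩

theorem lcs_le_lcsV {a b : Fin n} (hab : a ≠ b) {u v : List (Fin n)} (hu : u ∈ S.V a)
    (hv : v ∈ S.V b) : lcs u v ≤ S.lcsV :=
  le_csSup ⟨L, by
    rintro _ ⟨a, b, -, u, hu, v, -, rfl⟩
    exact (lcs_le_length u v).trans (S.V_length a u hu).le⟩ ⟨a, b, hab, u, hu, v, hv, rfl⟩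

variable (S ε E) in
/-- The standing assumptions on the parameters and the images. -/
structure Admissible : Prop where
  five_le : 5 ≤ n
  one_lt : 1 < L
  eps_nonneg : 0 ≤ ε
  cons : S.Consistent ε E
  eps_mul : ε * ((L : ℚ) - 1) = (S.lcsV : ℚ) + (S.lcpV : ℚ)

namespace Admissible

theorem ne_of_ne (A : S.Admissible ε E) {a b : Fin n} (hab : a ≠ b) {u v : List (Fin n)}
    (hu : u ∈ S.V a) (hv : v ∈ S.V b) : u ≠ v := by
  rintro rfl
  have hL := A.one_lt
  refine A.cons.uf12 a b hab u hu u hv u ?_ (List.suffix_refl u) (List.prefix_refl u)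
  rintro rfl
  have := S.V_length a _ hu
  simp at this
  omega

/-- Condition (3.1), applied to a pair of images that attains the maximal common prefix. -/
theorem lcs_add_lcp_add_eps_le (A : S.Admissible ε E) : (S.lcsV : ℚ) + S.lcpV + ε ≤ L := by
  have hn := A.five_le
  have hab : (⟨0, by omega⟩ : Fin n) ≠ ⟨1, by omega⟩ := by simp
  obtain ⟨u, hu⟩ := S.V_nonempty ⟨0, by omega⟩
  obtain ⟨v, hv⟩ := S.V_nonempty ⟨1, by omega⟩
  have hmem : S.lcpV ∈ {k : ℕ | ∃ a b, a ≠ b ∧ ∃ u ∈ S.V a, ∃ v ∈ S.V b, k = lcp u v} :=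
    Nat.sSup_mem ⟨_, _, _, hab, u, hu, v, hv, rfl⟩ bddAbove_lcpV
  obtain ⟨a, b, hab', u', hu', v', hv', he⟩ := hmem
  have := (A.cons.uf31 a b u' hu' v' hv' (A.ne_of_ne hab' hu' hv')).1
  rw [← he] at this
  linarith

/-- Adding ε to ε(L - 1) = lcs + lcp gives εL ≤ L. -/
theorem eps_le_one (A : S.Admissible ε E) : ε ≤ 1 := by
  have h1 := A.lcs_add_lcp_add_eps_le
  have h2 := A.eps_mul
  have h3 : (1 : ℚ) < L := by exact_mod_cast A.one_lt
  nlinarith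

/-- If ε = 0, then lcs = lcp = 0, so the first letters of chosen images of the n letters are
distinct and exhaust the alphabet. The last letter of an image is then the first letter of some
image, against (1.2) if the letters differ and against (1.1) if they agree. -/
theorem eps_pos (A : S.Admissible ε E) : 0 < ε := by
  refine lt_of_le_of_ne A.eps_nonneg fun h0 => ?_
  have hL := A.one_lt
  have hzero : S.lcsV = 0 ∧ S.lcpV = 0 := by
    have h1 := A.eps_mul
    rw [← h0, zero_mul] at h1
    have h2 : S.lcsV + S.lcpV = 0 := by exact_mod_cast h1.symm
    omega
  choose u hu using S.V_nonempty
  have hlen := fun a => S.V_length a (u a) (hu a)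
  have hfirst : ∀ a, ∃ c, [c] <+: u a := fun a => by
    obtain ⟨c, t, h⟩ := List.exists_cons_of_length_pos (l := u a) (by rw [hlen]; omega)
    exact ⟨c, t, h.symm⟩
  have hlast : ∀ a, ∃ c, [c] <:+ u a := fun a => by
    rcases List.eq_nil_or_concat (u a) with h | ⟨t, c, h⟩
    · have := hlen a
      rw [h] at this
      simp at this; omega
    · exact ⟨c, t, by rw [h, List.concat_eq_append]⟩
  choose F hF using hfirst
  choose G hG using hlast
  have hinj : Function.Injective F := fun a b hab => by
    by_contra hne
    have h1 := length_le_lcp (hF a) (hab ▸ hF b)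
    have h2 := lcp_le_lcpV hne (hu a) (hu b)
    simp at h1; omega
  let a : Fin n := ⟨0, by have := A.five_le; omega⟩
  obtain ⟨b, hb⟩ := (Finite.injective_iff_surjective.1 hinj) (G a)
  rcases eq_or_ne a b with rfl | hne
  -- An image that begins and ends with the same letter has period L - 1.
  · have hper : (u a).HasPeriod (L - 1) := by
      rw [List.hasPeriod_iff_getElem?]
      intro i hi
      rw [hlen] at hi
      obtain rfl : i = 0 := by omega
      obtain ⟨s, hs⟩ := hF a
      obtain ⟨t, ht⟩ := hG a
      have h1 : t.length = L - 1 := by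
        have := congrArg List.length ht
        rw [hlen] at this
        simp at this; omega
      have h2 : (u a)[0]? = some (F a) := by rw [← hs]; simp
      have h3 : (u a)[0 + (L - 1)]? = some (G a) := by rw [← ht, ← h1]; simp
      rw [h2, h3, hb]
    have h1 := A.cons.uf11 a (u a) (hu a)
    have h2 : period (u a) ≤ L - 1 := Nat.sInf_le ⟨by omega, hper⟩
    omega
  · exact A.cons.uf12 a b hne (u a) (hu a) (u b) (hu b) [G a] (by simp) (hG a) (hb ▸ hF b)

/-- Here r + ε ≤ r + 1 ≤ L, so a root of n - 1 blocks is long enough. -/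
theorem repBound_of_lt (A : S.Admissible ε E) {p r : ℕ} (hr : r < L) (hp : (n - 1) * L ≤ p) :
    RepBound n ε E p r := by
  have hn := A.five_le
  have h1 : (5 : ℚ) ≤ n := by exact_mod_cast hn
  have h2 : ((n - 1 : ℕ) : ℚ) * L ≤ p := by exact_mod_cast hp
  rw [Nat.cast_sub (by omega)] at h2
  push_cast at h2
  have h3 : (r : ℚ) + 1 ≤ L := by exact_mod_cast hr
  refine .of_le hn A.eps_nonneg (le_trans ?_ h2)
  have := A.eps_le_one
  nlinarith

end Admissible

/-! ### Repetitions whose root length is not a multiple of L -/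

variable (S ε E) in
/-- `f` starts with the image of the first `N` letters of the `(ε, E)`-threshold word `g` under the
substitution `ψ`. -/
structure IsImage (g : ℕ → Fin n) (ψ : ℕ → List (Fin n)) (f : ℕ → Fin n) (N : ℕ) : Prop where
  adm : S.Admissible ε E
  good : Good ε E g N
  subst : S.IsSubst ε E g ψ N
  eq_seg : ∀ q < N, ψ q = seg f (q * L) L

namespace IsImage

variable {g : ℕ → Fin n} {ψ : ℕ → List (Fin n)} {f : ℕ → Fin n} {N : ℕ}

theorem mem (H : S.IsImage ε E g ψ f N) {q : ℕ} (hq : q < N) : seg f (q * L) L ∈ S.V (g q) :=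
  H.eq_seg q hq ▸ H.subst.mem q hq

theorem follows (H : S.IsImage ε E g ψ f N) {q : ℕ} (hq : q + 1 < N) :
    seg f ((q + 1) * L) L ∈ S.δ (g (q + 1)) (seg f (q * L) L) := by
  have := H.subst.follows q hq
  rwa [H.eq_seg q (by omega), H.eq_seg (q + 1) hq] at this

theorem dist (H : S.IsImage ε E g ψ f N) {q q' : ℕ} (hq : q < q') (hq' : q' < N)
    (he : g q = g q') : n - 1 ≤ q' - q :=
  H.good.dist H.adm.five_le H.adm.eps_nonneg hq hq' he

theorem adj (H : S.IsImage ε E g ψ f N) {q : ℕ} (hq : q + 1 < N) : g q ≠ g (q + 1) := fun he => by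
  have h1 := H.dist (Nat.lt_succ_self q) hq he
  have h2 := H.adm.five_le
  omega

/-- Condition (1.2) as a synchronisation property: an overlap of the end of one block with the start
of another identifies their letters. -/
theorem letter_eq (H : S.IsImage ε E g ψ f N) {q q' c i : ℕ} (hq : q < N) (hq' : q' < N)
    (hc : 0 < c) (hcL : c ≤ L) (hi : i + c = q * L + L) (h : seg f i c = seg f (q' * L) c) :
    g q = g q' := by
  by_contra hne
  refine H.adm.cons.uf12 _ _ hne _ (H.mem hq) _ (H.mem hq') (seg f i c) (seg_ne_nil f _ hc)
    (seg_suffix f (by omega) hcL) ?_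
  rw [h]
  exact seg_prefix f _ hcL

/-- Both occurrences lie in the same image. -/
theorem repBound_same (H : S.IsImage ε E g ψ f N) {q o p r : ℕ} (hq : q < N) (hr : 0 < r)
    (hrp : r ≤ p) (ho : o + p + r ≤ L) (h : RepAt f (q * L + o) p r) : RepBound n ε E p r := by
  have hx : seg f (q * L + o + p) r = seg f (q * L + o) r := h.seg_eq le_rfl rfl le_rfl
  have hs := H.adm.cons.uf210 _ _ (H.mem hq) (seg f (q * L + o) r)
    (seg f (q * L + o + r) (p - r)) (seg_ne_nil f _ hr) ?_
  · unfold IsExponential at hs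
    simp only [List.length_append, length_seg] at hs
    exact .of_expBound H.adm.five_le (by omega) (by omega) hs
  · have : seg f (q * L + o) (p + r) = seg f (q * L + o) r ++ seg f (q * L + o + r) (p - r) ++
        seg f (q * L + o + p) r := seg_split3 f rfl (by omega) (by omega)
    rw [hx] at this
    rw [← this]
    exact seg_infix f (by omega) (by omega)

/-- The occurrences lie in two different images. -/
theorem repBound_inside (H : S.IsImage ε E g ψ f N) {q q' o o' p r : ℕ} (hq : q < q') (hq' : q' < N)
    (hr : 0 < r) (hrL : r < L) (ho : o + r ≤ L) (ho' : o' + r ≤ L)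
    (hp : q * L + o + p = q' * L + o') (h : RepAt f (q * L + o) p r) : RepBound n ε E p r := by
  obtain ⟨k, rfl⟩ : ∃ k, q' = q + 1 + k := ⟨q' - q - 1, by omega⟩
  have hx : seg f ((q + 1 + k) * L + o') r = seg f (q * L + o) r := h.seg_eq le_rfl hp.symm le_rfl
  have hs := H.adm.cons.uf212 _ _ _ (H.mem (by omega : q < N)) _ (H.mem hq') (seg f (q * L) o)
    (seg f ((q + 1 + k) * L + o' + r) (L - o' - r)) (seg f (q * L + o) r)
    (seg f (q * L + o + r) (L - o - r)) (seg f ((q + 1 + k) * L) o')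
    (seg_ne_nil f _ hr) (by simpa using hrL) (seg_split3 f rfl rfl (by omega))
    (by rw [← hx]; exact seg_split3 f rfl rfl (by omega))
  simp only [List.length_append, length_seg] at hs
  have hgap := gap_le H.adm.five_le H.adm.eps_nonneg H.good H.subst H.eq_seg (i := q) (c := 1)
    (k := k) (c' := 1) (by omega)
  rw [one_mul] at hgap
  refine hs.repBound H.adm.five_le hgap (by omega) ?_
  have : (q + 1 + k) * L = q * L + L + k * L := by ring
  omega

/-- The first occurrence lies in an image, the second one starts in the same image and ends in the
next one. -/
theorem repBound_same_right (H : S.IsImage ε E g ψ f N) {q o p a b : ℕ} (hq : q + 1 < N)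
    (ha : 0 < a) (hb : 0 < b) (hrp : a + b ≤ p) (ho : o + p + a = L)
    (h : RepAt f (q * L + o) p (a + b)) : RepBound n ε E p (a + b) := by
  have e1 : (q + 1) * L = q * L + L := by ring
  have hx : seg f (q * L + o + p) a = seg f (q * L + o) a := h.seg_eq le_rfl rfl (by omega)
  have hy : seg f ((q + 1) * L) b = seg f (q * L + o + a) b :=
    h.seg_eq (by omega) (by omega) (by omega)
  have hu : seg f (q * L) L = seg f (q * L) o ++ seg f (q * L + o) a ++ seg f (q * L + o + a) b ++
      seg f (q * L + o + a + b) (p - a - b) ++ seg f (q * L + o + p) a :=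
    seg_split5 f rfl rfl rfl (by omega) (by omega)
  rw [hx] at hu
  have hs := H.adm.cons.uf211 _ _ (H.adj hq) _ (H.mem (by omega : q < N)) _ (H.follows hq) _
    (seg f ((q + 1) * L + b) (L - b)) _ _ _ (seg_ne_nil f _ ha) (seg_ne_nil f _ hb) hu
    (by rw [← hy]; exact seg_split f rfl (by omega))
  unfold IsExponential at hs
  simp only [List.length_append, length_seg] at hs
  exact .of_expBound H.adm.five_le (by omega) (by omega) hs

/-- The second occurrence lies in an image, the first one starts in the preceding image and ends in
the same image. -/
theorem repBound_left_same (H : S.IsImage ε E g ψ f N) {q i p a b : ℕ} (hq : q + 1 < N)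
    (ha : 0 < a) (haL : a ≤ L) (hb : 0 < b) (hrp : a + b ≤ p) (hi : i + a = q * L + L)
    (hp : i + p + a + b ≤ q * L + L + L) (h : RepAt f i p (a + b)) :
    RepBound n ε E p (a + b) := by
  have e1 : (q + 1) * L = q * L + L := by ring
  have hx : seg f (i + p) a = seg f i a := h.seg_eq le_rfl rfl (by omega)
  have hy : seg f (i + p + a) b = seg f ((q + 1) * L) b :=
    h.seg_eq (by omega) (by omega) (by omega)
  have hv : seg f ((q + 1) * L) L = seg f ((q + 1) * L) b ++ seg f ((q + 1) * L + b) (p - a - b) ++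
      seg f (i + p) a ++ seg f (i + p + a) b ++
      seg f (i + p + a + b) (q * L + L + L - (i + p + a + b)) :=
    seg_split5 f rfl (by omega) rfl rfl (by omega)
  rw [hx, hy] at hv
  have hs := H.adm.cons.uf213 _ _ (H.adj hq) _ (H.mem (by omega : q < N)) _ (H.follows hq)
    (seg f (q * L) (L - a)) _ _ _ _ (seg_ne_nil f _ ha) (seg_ne_nil f _ hb)
    (seg_split f (by omega) (by omega)) hv
  unfold IsExponential at hs
  simp only [List.length_append, length_seg] at hs
  exact .of_expBound H.adm.five_le (by omega) (by omega) hs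

/-- The first occurrence lies in an image, the second one meets two later images. -/
theorem repBound_inside_across (H : S.IsImage ε E g ψ f N) {q q' o p a b : ℕ} (hq : q < q')
    (hq' : q' + 1 < N) (ha : 0 < a) (hb : 0 < b) (ho : o + a + b ≤ L)
    (hrL : a + b < L) (hp : q * L + o + p + a = q' * L + L)
    (h : RepAt f (q * L + o) p (a + b)) : RepBound n ε E p (a + b) := by
  -- Condition (2.2.3) requires these letters to differ. If they agree, they are at least n - 1
  -- positions apart and the root is long enough anyway.
  by_cases hqq : g q = g q'
  · have h1 := H.dist hq (by omega) hqq
    have h2 := Nat.mul_le_mul_right L h1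
    have h3 : q' * L = q * L + (q' - q) * L := by rw [← Nat.add_mul]; congr 1; omega
    exact H.adm.repBound_of_lt hrL (by omega)
  obtain ⟨k, rfl⟩ : ∃ k, q' = q + 1 + k := ⟨q' - q - 1, by omega⟩
  have e1 : (q + 1 + k + 1) * L = (q + 1 + k) * L + L := by ring
  have e2 : (q + 1 + k) * L = q * L + L + k * L := by ring
  have hx : seg f (q * L + o + p) a = seg f (q * L + o) a := h.seg_eq le_rfl rfl (by omega)
  have hy : seg f ((q + 1 + k + 1) * L) b = seg f (q * L + o + a) b :=
    h.seg_eq (by omega) (by omega) (by omega)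
  have hs := H.adm.cons.uf223 _ _ _ hqq (H.adj hq') _ (H.mem (by omega)) _ (H.mem (by omega))
    _ (H.mem hq') (seg f (q * L) o) (seg f ((q + 1 + k + 1) * L + b) (L - b))
    (seg f (q * L + o) a) (seg f (q * L + o + a) b) (seg f (q * L + o + a + b) (L - o - a - b))
    (seg f ((q + 1 + k) * L) (L - a)) (seg_ne_nil f _ ha) (seg_ne_nil f _ hb)
    (seg_split4 f rfl rfl rfl (by omega))
    (by rw [← hx]; exact seg_split f (by omega) (by omega))
    (by rw [← hy]; exact seg_split f (by omega) (by omega))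
  simp only [List.length_append, length_seg] at hs
  have hgap := gap_le H.adm.five_le H.adm.eps_nonneg H.good H.subst H.eq_seg (i := q) (c := 1)
    (k := k) (c' := 2) (by omega)
  rw [one_mul, seg_split f (i := (q + 1 + k) * L) (a := L) (b := L) (c := 2 * L) e1
    (Nat.two_mul L)] at hgap
  exact hs.repBound H.adm.five_le hgap (by omega) (by omega)

/-- The first occurrence meets two images, the second one lies in a later image. -/
theorem repBound_across_inside (H : S.IsImage ε E g ψ f N) {q q' o i p a b : ℕ} (hq : q + 1 < q')
    (hq' : q' < N) (ha : 0 < a) (hb : 0 < b) (ho : o + a + b ≤ L)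
    (hrL : a + b < L) (hi : i + a = q * L + L) (hp : i + p = q' * L + o)
    (h : RepAt f i p (a + b)) : RepBound n ε E p (a + b) := by
  -- As above: equal letters are excluded from (2.2.1) but force a root of length at least (n - 1)L.
  by_cases hqq : g (q + 1) = g q'
  · have h1 := H.dist hq (by omega) hqq
    have h2 := Nat.mul_le_mul_right L h1
    have h3 : q' * L = q * L + L + (q' - (q + 1)) * L := by
      rw [← Nat.succ_mul, ← Nat.add_mul]; congr 1; omega
    exact H.adm.repBound_of_lt hrL (by omega)
  obtain ⟨k, rfl⟩ : ∃ k, q' = q + 2 + k := ⟨q' - q - 2, by omega⟩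
  have e1 : (q + 1) * L = q * L + L := by ring
  have e2 : (q + 2 + k) * L = q * L + L + L + k * L := by ring
  have hx : seg f ((q + 2 + k) * L + o) a = seg f i a := h.seg_eq le_rfl hp.symm (by omega)
  have hy : seg f ((q + 2 + k) * L + o + a) b = seg f ((q + 1) * L) b :=
    h.seg_eq (by omega) (by omega) (by omega)
  have hs := H.adm.cons.uf221 _ _ _ (H.adj (by omega : q + 1 < N)) hqq _ (H.mem (by omega)) _
    (H.mem (by omega)) _ (H.mem hq') (seg f (q * L) (L - a))
    (seg f ((q + 2 + k) * L + o + a + b) (L - o - a - b))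
    (seg f i a) (seg f ((q + 1) * L) b) (seg f ((q + 1) * L + b) (L - b))
    (seg f ((q + 2 + k) * L) o) (seg_ne_nil f _ ha) (seg_ne_nil f _ hb)
    (seg_split f (by omega) (by omega)) (seg_split f rfl (by omega))
    (by rw [← hx, ← hy]; exact seg_split4 f rfl rfl rfl (by omega))
  simp only [List.length_append, length_seg] at hs
  have hgap := gap_le H.adm.five_le H.adm.eps_nonneg H.good H.subst H.eq_seg (i := q) (c := 2)
    (k := k) (c' := 1) (by omega)
  rw [one_mul, seg_split f (i := q * L) (a := L) (b := L) (c := 2 * L) e1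
    (Nat.two_mul L)] at hgap
  exact hs.repBound H.adm.five_le hgap (by omega) (by omega)

end IsImage

end ImageSystem

theorem period_seg_le {n : ℕ} {f : ℕ → Fin n} {i p c : ℕ} (hp : 0 < p)
    (h : RepAt f i p (c - p)) : period (seg f i c) ≤ p := by
  refine Nat.sInf_le ⟨hp, List.hasPeriod_iff_getElem?.2 fun t ht => ?_⟩
  rw [length_seg] at ht
  rw [getElem?_seg f (by omega), getElem?_seg f (by omega), h t ht, Nat.add_assoc]

namespace ImageSystem

variable {n L : ℕ} {S : ImageSystem n L} {ε : ℚ} {E : Set ℕ}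

namespace IsImage

variable {g : ℕ → Fin n} {ψ : ℕ → List (Fin n)} {f : ℕ → Fin n} {N : ℕ}

/-- Both occurrences meet two images, and the first one is cut earlier than the second one. -/
theorem repBound_cut_lt (H : S.IsImage ε E g ψ f N) {q q' i p a b c : ℕ} (hp0 : 0 < p)
    (hq : q + 1 < N) (hq' : q' + 1 < N) (ha : 0 < a) (hb : 0 < b) (hc : 0 < c)
    (hab : a + b ≤ L) (hbc : b + c ≤ L) (hi : i + a = q * L + L) (hp : i + p + a + b = q' * L + L)
    (h : RepAt f i p (a + b + c)) : RepBound n ε E p (a + b + c) := by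
  have hn := H.adm.five_le
  have e1 : (q + 1) * L = q * L + L := by ring
  have e2 : (q' + 1) * L = q' * L + L := by ring
  have hx : seg f (i + p) a = seg f i a := h.seg_eq le_rfl rfl (by omega)
  have hy : seg f (i + p + a) b = seg f ((q + 1) * L) b :=
    h.seg_eq (by omega) (by omega) (by omega)
  have hz : seg f ((q' + 1) * L) c = seg f ((q + 1) * L + b) c :=
    h.seg_eq (by omega) (by omega) (by omega)
  have hlt : q < q' := by
    by_contra hle
    have := Nat.mul_le_mul_right L (Nat.le_of_not_lt hle)
    omega
  -- The middle piece is a suffix of block q' and a prefix of block q + 1, so both carry the same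
  -- letter. If they are one block, that block has a border of length b, against (1.1); otherwise
  -- the two positions are at least n - 1 apart.
  have hle : L * (n - 2) + b ≤ p := by
    have hgq : g q' = g (q + 1) := H.letter_eq (by omega) hq hb (by omega) (by omega) hy
    rcases Nat.eq_or_lt_of_le (Nat.succ_le_of_lt hlt) with rfl | hlt'
    · have h1 := H.adm.cons.uf11 _ _ (H.mem hq)
      have h2 : period (seg f ((q + 1) * L) L) ≤ L - b := by
        refine period_seg_le (by omega) ?_
        rw [show L - (L - b) = b by omega]
        apply repAt_of_seg_eq
        rw [← hy]
        congr 1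
        rw [Nat.succ_eq_add_one] at hp
        omega
      omega
    · have h1 := Nat.mul_le_mul_right L (H.dist hlt' (by omega) hgq.symm)
      have h3 : q' * L = q * L + L + (q' - (q + 1)) * L := by
        rw [← Nat.succ_mul, ← Nat.add_mul]; congr 1; omega
      have h4 : (n - 1) * L = L * (n - 2) + L := by
        rw [Nat.mul_comm L, ← Nat.succ_mul]; congr 1; omega
      rw [Nat.succ_eq_add_one] at h1
      omega
  have hs := H.adm.cons.uf32 _ _ _ _ (H.adj hq) (H.adj hq') _ (H.mem (by omega)) _ (H.follows hq)
    _ (H.mem (by omega)) _ (H.follows hq') (seg f (q * L) (L - a))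
    (seg f ((q + 1) * L + b + c) (L - b - c)) (seg f (q' * L) (L - a - b))
    (seg f ((q' + 1) * L + c) (L - c)) (seg f i a) (seg f ((q + 1) * L) b)
    (seg f ((q + 1) * L + b) c) (seg_ne_nil f _ ha) (seg_ne_nil f _ hb) (seg_ne_nil f _ hc)
    (seg_split f (by omega) (by omega)) (seg_split3 f rfl rfl (by omega))
    (by rw [← hx, ← hy]; exact seg_split3 f (by omega) rfl (by omega))
    (by rw [← hz]; exact seg_split f rfl (by omega))
  simp only [List.length_append, length_seg] at hs
  exact .of_expBound hn (by omega) hle hs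

/-- Both occurrences meet two images, and the first one is cut later than the second one. -/
theorem repBound_cut_gt (H : S.IsImage ε E g ψ f N) {q q' i p a b c : ℕ} (hp0 : 0 < p)
    (hq : q + 1 < N) (hq' : q' + 1 < N) (ha : 0 < a) (hb : 0 < b) (hc : 0 < c)
    (hab : a + b ≤ L) (hbc : b + c ≤ L) (hi : i + a + b = q * L + L) (hp : i + p + a = q' * L + L)
    (h : RepAt f i p (a + b + c)) : RepBound n ε E p (a + b + c) := by
  have hn := H.adm.five_le
  have e1 : (q + 1) * L = q * L + L := by ring
  have e2 : (q' + 1) * L = q' * L + L := by ring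
  have hx : seg f (i + p) a = seg f i a := h.seg_eq le_rfl rfl (by omega)
  have hy : seg f ((q' + 1) * L) b = seg f (i + a) b :=
    h.seg_eq (by omega) (by omega) (by omega)
  have hz : seg f ((q' + 1) * L + b) c = seg f ((q + 1) * L) c :=
    h.seg_eq (by omega) (by omega) (by omega)
  have hlt : q < q' + 1 := by
    by_contra hle
    have := Nat.mul_le_mul_right L (Nat.le_of_not_lt hle)
    omega
  -- Now blocks q and q' + 1 carry the same letter, hence q' - q ≥ n - 2, while p = (q' - q)L + b.
  -- This is the root length in (3.2).
  have hle : L * (n - 2) + b ≤ p := by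
    have hgq : g q = g (q' + 1) :=
      H.letter_eq (by omega) hq' hb (by omega) (by omega) hy.symm
    have h1 := Nat.mul_le_mul_right L (H.dist hlt (by omega) hgq)
    have h3 : (q' + 1) * L = q * L + (q' + 1 - q) * L := by
      rw [← Nat.add_mul]; congr 1; omega
    have h4 : (n - 1) * L = L * (n - 2) + L := by
      rw [Nat.mul_comm L, ← Nat.succ_mul]; congr 1; omega
    omega
  have hs := H.adm.cons.uf32 _ _ _ _ (H.adj hq') (H.adj hq) _ (H.mem (by omega)) _ (H.follows hq')
    _ (H.mem (by omega)) _ (H.follows hq) (seg f (q' * L) (L - a))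
    (seg f ((q' + 1) * L + b + c) (L - b - c)) (seg f (q * L) (L - a - b))
    (seg f ((q + 1) * L + c) (L - c)) (seg f i a) (seg f (i + a) b)
    (seg f ((q + 1) * L) c) (seg_ne_nil f _ ha) (seg_ne_nil f _ hb) (seg_ne_nil f _ hc)
    (by rw [← hx]; exact seg_split f (by omega) (by omega))
    (by rw [← hy, ← hz]; exact seg_split3 f rfl rfl (by omega))
    (seg_split3 f (by omega) rfl (by omega)) (seg_split f rfl (by omega))
  simp only [List.length_append, length_seg] at hs
  exact .of_expBound hn (by omega) hle hs

/-- An image can only occur at a boundary of two images. -/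
theorem dvd_of_seg_eq (H : S.IsImage ε E g ψ f N) {b j : ℕ} (hb : b < N) (hj : j + L ≤ N * L)
    (h : seg f (b * L) L = seg f j L) : L ∣ j := by
  have hL := H.adm.one_lt
  by_contra hdvd
  have ho : 0 < j % L := Nat.pos_of_ne_zero fun h0 => hdvd (Nat.dvd_of_mod_eq_zero h0)
  have hoL : j % L < L := Nat.mod_lt _ (by omega)
  have hj' : j = j / L * L + j % L := (Nat.div_add_mod' j L).symm
  set q := j / L
  set o := j % L
  have e1 : (q + 1) * L = q * L + L := by ring
  have hq : q + 1 < N := by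
    by_contra hle
    have := Nat.mul_le_mul_right L (Nat.le_of_not_lt hle)
    omega
  have hpt : ∀ t < L, f (b * L + t) = f (j + t) := fun t ht => eq_of_seg_eq h ht
  -- An image at offset o > 0 in block q begins with a suffix of that block and ends with a prefix
  -- of block q + 1. Both neighbours then carry its letter, impossible for adjacent letters.
  have h1 : g q = g b := by
    refine H.letter_eq (c := L - o) (i := j) (by omega) hb (by omega) (by omega) (by omega) ?_
    exact seg_congr fun t ht => (hpt t (by omega)).symm
  have h2 : g b = g (q + 1) := by
    refine H.letter_eq (c := o) (i := b * L + (L - o)) hb hq ho (by omega) (by omega) ?_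
    refine seg_congr fun t ht => ?_
    rw [Nat.add_assoc, hpt _ (by omega)]
    congr 1
    omega
  exact H.adj hq (h1.trans h2)

/-- A whole block inside either occurrence would reappear at a shift by p, which is not a block
boundary. So each occurrence is cut at most once, and two cuts fall at different places of the
repeated part; the preceding lemmas cover all the cases. -/
theorem repBound_of_not_dvd (H : S.IsImage ε E g ψ f N) {i p r : ℕ} (hr : 0 < r) (hrp : r ≤ p)
    (hi : i + p + r ≤ N * L) (hdvd : ¬ L ∣ p) (h : RepAt f i p r) : RepBound n ε E p r := by
  have hL := H.adm.one_lt
  have hblock1 : ∀ b, i ≤ b * L → ¬ b * L + L ≤ i + r := fun b h1 h2 => by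
    have hb : b < N := by
      by_contra hle
      have := Nat.mul_le_mul_right L (Nat.le_of_not_lt hle)
      omega
    have h3 := H.dvd_of_seg_eq hb (j := b * L + p) (by omega) (h.seg_eq h1 rfl h2).symm
    exact hdvd ((Nat.dvd_add_right (Nat.dvd_mul_left L b)).1 h3)
  have hblock2 : ∀ b, i + p ≤ b * L → ¬ b * L + L ≤ i + p + r := fun b h1 h2 => by
    have hb : b < N := by
      by_contra hle
      have := Nat.mul_le_mul_right L (Nat.le_of_not_lt hle)
      omega
    have h3 := H.dvd_of_seg_eq hb (j := b * L - p) (by omega)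
      (h.seg_eq (by omega) (by omega) (by omega))
    have h4 : b * L = b * L - p + p := by omega
    exact hdvd ((Nat.dvd_add_right h3).1 (h4 ▸ Nat.dvd_mul_left L b))
  obtain ⟨q, o, hoL, rfl⟩ : ∃ q o, o < L ∧ i = q * L + o :=
    ⟨i / L, i % L, Nat.mod_lt _ (by omega), (Nat.div_add_mod' i L).symm⟩
  obtain ⟨q', o', hoL', hp⟩ : ∃ q' o', o' < L ∧ q * L + o + p = q' * L + o' :=
    ⟨(q * L + o + p) / L, (q * L + o + p) % L, Nat.mod_lt _ (by omega),
      (Nat.div_add_mod' _ L).symm⟩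
  have e1 : (q + 1) * L = q * L + L := by ring
  have e2 : (q' + 1) * L = q' * L + L := by ring
  have b1 := hblock1 q
  have b2 := hblock1 (q + 1)
  have b3 := hblock2 q'
  have b4 := hblock2 (q' + 1)
  have hqq : q ≤ q' := by
    by_contra hle
    have := Nat.mul_le_mul_right L (Nat.succ_le_of_lt (Nat.lt_of_not_le hle))
    rw [Nat.succ_eq_add_one] at this
    omega
  have hltN : ∀ s, s * L < N * L → s < N := fun s hs => lt_of_mul_lt_mul_right hs (Nat.zero_le L)
  have hq'N : q' < N := hltN q' (by omega)
  have hne : o ≠ o' := by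
    rintro rfl
    have h5 : p + q * L = q' * L := by omega
    exact hdvd ((Nat.dvd_add_left (Nat.dvd_mul_left L q)).1 (h5 ▸ Nat.dvd_mul_left L q'))
  by_cases hin : o + r ≤ L
  · by_cases hin' : o' + r ≤ L
    · rcases Nat.eq_or_lt_of_le hqq with rfl | hlt
      · exact H.repBound_same hq'N hr hrp (by omega) h
      · exact H.repBound_inside hlt hq'N hr (by omega) hin hin' hp h
    · have hq'1 : q' + 1 < N := hltN (q' + 1) (by omega)
      obtain ⟨b, rfl⟩ : ∃ b, r = (L - o') + b := ⟨r - (L - o'), by omega⟩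
      rcases Nat.eq_or_lt_of_le hqq with rfl | hlt
      · exact H.repBound_same_right hq'1 (by omega) (by omega) hrp (by omega) h
      · exact H.repBound_inside_across hlt hq'1 (by omega) (by omega) (by omega) (by omega)
          (by omega) h
  · have hq1 : q + 1 < N := hltN (q + 1) (by omega)
    by_cases hin' : o' + r ≤ L
    · obtain ⟨b, rfl⟩ : ∃ b, r = (L - o) + b := ⟨r - (L - o), by omega⟩
      rcases Nat.lt_trichotomy (q + 1) q' with hlt | rfl | hlt
      · exact H.repBound_across_inside hlt hq'N (by omega) (by omega) (o := o') (by omega)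
          (by omega) (by omega) hp h
      · exact H.repBound_left_same hq1 (by omega) (by omega) (by omega) hrp (by omega) (by omega) h
      · obtain rfl : q = q' := by omega
        omega
    · have hq'1 : q' + 1 < N := hltN (q' + 1) (by omega)
      rcases Nat.lt_or_gt_of_ne hne with hlt | hlt
      · obtain ⟨c, rfl⟩ : ∃ c, r = (L - o') + (o' - o) + c := ⟨r - (L - o), by omega⟩
        exact H.repBound_cut_gt (by omega) hq1 hq'1 (by omega) (by omega) (by omega) (by omega)
          (by omega) (by omega) (by omega) h
      · obtain ⟨c, rfl⟩ : ∃ c, r = (L - o) + (o - o') + c := ⟨r - (L - o'), by omega⟩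
        exact H.repBound_cut_lt (by omega) hq1 hq'1 (by omega) (by omega) (by omega) (by omega)
          (by omega) (by omega) (by omega) h

/-! ### Repetitions whose root length is a multiple of L -/

theorem eq_of_seg_eq (H : S.IsImage ε E g ψ f N) {q q' : ℕ} (hq : q < N) (hq' : q' < N)
    (h : seg f (q * L) L = seg f (q' * L) L) : g q = g q' := by
  have hL := H.adm.one_lt
  exact H.letter_eq hq hq' (by omega) le_rfl rfl h

/-- A common suffix of two images: a bound if the letters differ, and one if the images of a letter
differ. -/
theorem commonSuffix_le (H : S.IsImage ε E g ψ f N) {q q' i j s : ℕ} (hq : q < N) (hq' : q' < N)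
    (hs : s ≤ L) (hi : i + s = q * L + L) (hj : j + s = q' * L + L)
    (h : seg f i s = seg f j s) :
    (g q ≠ g q' → s ≤ S.lcsV) ∧
      (seg f (q * L) L ≠ seg f (q' * L) L → (s : ℚ) ≤ L - S.lcpV - ε) := by
  have hle := length_le_lcs (seg_suffix f (i := q * L) (c := L) (by omega) hs)
    (h ▸ seg_suffix f (i := q' * L) (c := L) (by omega) hs : seg f i s <:+ seg f (q' * L) L)
  rw [length_seg] at hle
  refine ⟨fun hne => hle.trans (lcs_le_lcsV hne (H.mem hq) (H.mem hq')), fun hne => ?_⟩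
  have h1 := (H.adm.cons.uf31 _ _ _ (H.mem hq) _ (H.mem hq') hne).2
  have h2 : (s : ℚ) ≤ (lcs (seg f (q * L) L) (seg f (q' * L) L) : ℕ) := by exact_mod_cast hle
  linarith

theorem commonPrefix_le (H : S.IsImage ε E g ψ f N) {q q' s : ℕ} (hq : q < N) (hq' : q' < N)
    (hs : s ≤ L) (h : seg f (q * L) s = seg f (q' * L) s) :
    (g q ≠ g q' → s ≤ S.lcpV) ∧
      (seg f (q * L) L ≠ seg f (q' * L) L → (s : ℚ) ≤ L - S.lcsV - ε) := by
  have hle := length_le_lcp (seg_prefix f (q * L) hs)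
    (h ▸ seg_prefix f (q' * L) hs : seg f (q * L) s <+: seg f (q' * L) L)
  rw [length_seg] at hle
  refine ⟨fun hne => hle.trans (lcp_le_lcpV hne (H.mem hq) (H.mem hq')), fun hne => ?_⟩
  have h1 := (H.adm.cons.uf31 _ _ _ (H.mem hq) _ (H.mem hq') hne).1
  have h2 : (s : ℚ) ≤ (lcp (seg f (q * L) L) (seg f (q' * L) L) : ℕ) := by exact_mod_cast hle
  linarith

/-- Both occurrences meet two images and are cut at the same place, the letters on both sides of the
cuts being different. -/
theorem repBound_cut_eq (H : S.IsImage ε E g ψ f N) {q k i p a b : ℕ} (hk : 0 < k)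
    (hq : q + k + 1 < N) (ha : 0 < a) (hb : 0 < b) (haL : a ≤ L) (hbL : b ≤ L)
    (habp : a + b ≤ p) (hi : i + a = q * L + L) (hp : p = k * L) (h1 : g q ≠ g (q + k))
    (h2 : g (q + 1) ≠ g (q + k + 1)) (h : RepAt f i p (a + b)) : RepBound n ε E p (a + b) := by
  have hn := H.adm.five_le
  have e1 : (q + 1) * L = q * L + L := by ring
  have e2 : (q + k) * L = q * L + k * L := by ring
  have e3 : (q + k + 1) * L = q * L + k * L + L := by ring
  have hx : seg f (i + p) a = seg f i a := h.seg_eq le_rfl rfl (by omega)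
  have hy : seg f ((q + k + 1) * L) b = seg f ((q + 1) * L) b :=
    h.seg_eq (by omega) (by omega) (by omega)
  -- For k = 1 the occurrences share the middle one of three consecutive images, whose letters are
  -- pairwise different: (2.2.2). For k ≥ 2 the two pairs of images are disjoint, with k - 2 images
  -- between them: (2.3).
  rcases Nat.eq_or_lt_of_le (Nat.succ_le_of_lt hk) with rfl | hk1
  · have hv : seg f ((q + 1) * L) L = seg f ((q + 1) * L) b ++ seg f ((q + 1) * L + b) (L - a - b) ++
        seg f (i + p) a := seg_split3 f rfl (by omega) (by omega)
    rw [hx] at hv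
    have hne : g (q + 1 + 1) ≠ g q := fun he => by
      have := H.dist (by omega : q < q + 1 + 1) hq he.symm
      omega
    have hs := H.adm.cons.uf222 _ _ _ (H.adj (by omega : q + 1 < N)) (H.adj hq) hne _
      (H.mem (by omega)) _ (H.follows (by omega)) _ (H.follows hq) (seg f (q * L) (L - a))
      (seg f ((q + 1 + 1) * L + b) (L - b)) _ _ _ (seg_ne_nil f _ ha) (seg_ne_nil f _ hb)
      (seg_split f (by omega) (by omega)) hv (by rw [← hy]; exact seg_split f rfl (by omega))
    unfold IsExponential at hs
    simp only [List.length_append, length_seg] at hs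
    exact .of_expBound hn (by omega) (by omega) hs
  · obtain ⟨m, rfl⟩ : ∃ m, k = m + 2 := ⟨k - 2, by omega⟩
    have e4 : (m + 2) * L = m * L + L + L := by ring
    have hs := H.adm.cons.uf23 _ _ _ _ (H.adj (by omega : q + 1 < N)) (H.adj hq) h1 h2
      _ (H.mem (by omega)) _ (H.follows (by omega)) _ (H.mem (by omega)) _ (H.follows hq)
      (seg f (q * L) (L - a)) (seg f ((q + (m + 2) + 1) * L + b) (L - b)) (seg f i a)
      (seg f ((q + 1) * L) b) (seg f ((q + 1) * L + b) (L - b))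
      (seg f ((q + (m + 2)) * L) (L - a)) (seg_ne_nil f _ ha) (seg_ne_nil f _ hb)
      (seg_split f (by omega) (by omega)) (seg_split f rfl (by omega))
      (by rw [← hx]; exact seg_split f (by omega) (by omega))
      (by rw [← hy]; exact seg_split f rfl (by omega))
    simp only [List.length_append, length_seg] at hs
    have hgap := gap_le hn H.adm.eps_nonneg H.good H.subst H.eq_seg (i := q) (c := 2)
      (k := m) (c' := 2) (by omega)
    rw [seg_split f (i := q * L) (a := L) (b := L) (c := 2 * L) e1 (Nat.two_mul L),
      show q + 2 + m = q + (m + 2) by omega,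
      seg_split f (i := (q + (m + 2)) * L) (j := (q + (m + 2) + 1) * L) (a := L) (b := L)
        (c := 2 * L) (by omega) (Nat.two_mul L)] at hgap
    exact hs.repBound hn hgap (by omega) (by omega)

/-- A repetition in `g` whose repeated part is preserved by the substitution. -/
theorem mul_le_of_repAt (H : S.IsImage ε E g ψ f N) {q k m : ℕ} (hk : 0 < k) (hm : 0 < m)
    (hN : q + k + m ≤ N) (h : ∀ j < m, seg f ((q + j) * L) L = seg f ((q + j + k) * L) L) :
    ((n : ℚ) - 1) * (m + ε) ≤ k := by
  have hrep : RepAt g q k m := fun t ht => H.eq_of_seg_eq (by omega) (by omega) (h t ht)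
  -- For m in E a failing bound would make (M2) separate the images; for m outside E the bound with
  -- the full ε is part of `Good`.
  by_cases hmE : m ∈ E
  · by_contra hlt
    obtain ⟨j, hj, hne⟩ := H.subst.splits q k m hk hm hN hrep hmE hlt
    apply hne
    rw [H.eq_seg _ (by omega), H.eq_seg _ (by omega)]
    exact h j hj
  · have := H.good q k m hk hm hN hrep
    rwa [RepBound, chi_of_notMem hmE, mul_one] at this

/-- The maximality hypotheses ensure that a partially covered pair of images at either end is a pair
of different words, which is what (3.1) needs. -/
theorem repBound_of_dvd (H : S.IsImage ε E g ψ f N) {i k r : ℕ} (hr : 0 < r) (hk : 0 < k)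
    (hi : i + k * L + r ≤ N * L) (h : RepAt f i (k * L) r)
    (hleft : 0 < i → f (i - 1) ≠ f (i - 1 + k * L))
    (hright : i + k * L + r < N * L → f (i + r) ≠ f (i + r + k * L)) :
    RepBound n ε E (k * L) r := by
  have hn := H.adm.five_le
  have hL := H.adm.one_lt
  have hkL : L ≤ k * L := Nat.le_mul_of_pos_left L hk
  have hltN : ∀ s, s * L < N * L → s < N := fun s hs => lt_of_mul_lt_mul_right hs (Nat.zero_le L)
  have hleN : ∀ s, s * L ≤ N * L → s ≤ N := fun s hs => le_of_mul_le_mul_right hs (by omega)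
  by_cases hin : ∃ q o, i = q * L + o ∧ o + r ≤ L ∧ r < L
  · obtain ⟨q, o, rfl, ho, hrL⟩ := hin
    have e2 : (q + k) * L = q * L + k * L := by ring
    exact H.repBound_inside (q' := q + k) (by omega) (hltN _ (by omega)) hr hrL ho ho (by omega) h
  -- The repeated part is a suffix of a block, m whole blocks and a prefix of a block. With m = 0
  -- both ends are nonempty, since repeated parts inside one image have been dealt with.
  obtain ⟨q, m, s, t, hs, ht, hiq, rfl, hst⟩ : ∃ q m s t, s < L ∧ t < L ∧ i + s = q * L ∧
      r = s + m * L + t ∧ (m = 0 → 0 < s ∧ 0 < t) := by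
    have d1 := Nat.div_add_mod' i L
    have d2 := Nat.mod_lt i (show 0 < L by omega)
    rcases Nat.eq_zero_or_pos (i % L) with h0 | h0
    · have hrL : L ≤ r := by
        by_contra hlt
        exact hin ⟨i / L, 0, by omega, by omega, by omega⟩
      refine ⟨i / L, r / L, 0, r % L, by omega, Nat.mod_lt _ (by omega), by omega, ?_, ?_⟩
      · have := Nat.div_add_mod' r L
        omega
      · intro h1
        have := Nat.div_pos hrL (by omega)
        omega
    · have hrL : L < i % L + r := by
        by_contra hlt
        exact hin ⟨i / L, i % L, by omega, by omega, by omega⟩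
      have e1 : (i / L + 1) * L = i / L * L + L := by ring
      have d3 := Nat.div_add_mod' (i % L + r - L) L
      refine ⟨i / L + 1, (i % L + r - L) / L, L - i % L, (i % L + r - L) % L, by omega,
        Nat.mod_lt _ (by omega), by omega, by omega, ?_⟩
      intro h1
      rw [h1] at d3
      omega
  have e2 : ∀ j, (q + j) * L = q * L + j * L := fun j => by ring
  have e3 : ∀ j, (q + j + k) * L = q * L + j * L + k * L := fun j => by ring
  have e4 : ∀ j, (j + 1) * L = j * L + L := fun j => by ring
  have hqN : q + m + k ≤ N := hleN _ (by have := e3 m; omega)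
  have hmid : ∀ j < m, seg f ((q + j) * L) L = seg f ((q + j + k) * L) L := fun j hj => by
    have h1 := Nat.mul_le_mul_right L (Nat.succ_le_of_lt hj)
    have h2 := e2 j
    have h3 := e3 j
    have h4 := e4 j
    rw [Nat.succ_eq_add_one] at h1
    exact (h.seg_eq (by omega) (by omega) (by omega)).symm
  have hmidg : ∀ j < m, g (q + j) = g (q + j + k) := fun j hj =>
    H.eq_of_seg_eq (by omega) (by omega) (hmid j hj)
  -- Left end: either the letters there differ (or s = 0) and s ≤ lcs, or one letter has two
  -- different images and (3.1) bounds s. The right end is symmetric.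
  have hl : (s ≤ S.lcsV ∧ (0 < s → ∃ q₀, q = q₀ + 1 ∧ g q₀ ≠ g (q₀ + k))) ∨
      (∃ q₀, q = q₀ + 1 ∧ g q₀ = g (q₀ + k) ∧ (s : ℚ) ≤ L - S.lcpV - ε) := by
    rcases Nat.eq_zero_or_pos s with rfl | hs0
    · exact .inl ⟨Nat.zero_le _, fun h0 => absurd h0 (lt_irrefl 0)⟩
    obtain ⟨q₀, rfl⟩ : ∃ q₀, q = q₀ + 1 := Nat.exists_eq_succ_of_ne_zero (by rintro rfl; omega)
    have h1 := e4 q₀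
    have h2 : (q₀ + k) * L = q₀ * L + k * L := by ring
    have hc := H.commonSuffix_le (q := q₀) (q' := q₀ + k) (i := i) (j := i + k * L) (s := s)
      (by omega) (by omega) hs.le (by omega) (by omega) (h.seg_eq le_rfl rfl (by omega)).symm
    by_cases hg : g q₀ = g (q₀ + k)
    · refine .inr ⟨q₀, rfl, hg, hc.2 fun heq => hleft (by omega) ?_⟩
      have := ThresholdWords.eq_of_seg_eq heq (t := i - 1 - q₀ * L) (by omega)
      rw [show q₀ * L + (i - 1 - q₀ * L) = i - 1 by omega] at this
      rw [this]; congr 1; omega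
    · exact .inl ⟨hc.1 hg, fun _ => ⟨q₀, rfl, hg⟩⟩
  have hrt : (t ≤ S.lcpV ∧ (0 < t → q + m + k < N ∧ g (q + m) ≠ g (q + m + k))) ∨
      (q + m + k < N ∧ g (q + m) = g (q + m + k) ∧ (t : ℚ) ≤ L - S.lcsV - ε) := by
    rcases Nat.eq_zero_or_pos t with rfl | ht0
    · exact .inl ⟨Nat.zero_le _, fun h0 => absurd h0 (lt_irrefl 0)⟩
    have h1 := e2 m
    have h2 := e3 m
    have hN : q + m + k < N := hltN _ (by omega)
    have hc := H.commonPrefix_le (q := q + m) (q' := q + m + k) (s := t)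
      (by omega) (by omega) ht.le (h.seg_eq (by omega) (by omega) (by omega)).symm
    by_cases hg : g (q + m) = g (q + m + k)
    · refine .inr ⟨hN, hg, hc.2 fun heq => hright ?_ ?_⟩
      · have h3 := Nat.mul_le_mul_right L (Nat.succ_le_of_lt hN)
        have h4 := e4 (q + m + k)
        rw [Nat.succ_eq_add_one] at h3
        omega
      · have := ThresholdWords.eq_of_seg_eq heq (t := t) (by omega)
        rw [show (q + m) * L + t = i + (s + m * L + t) by omega] at this
        rw [this]; congr 1; omega
    · exact .inl ⟨hc.1 hg, fun _ => ⟨hN, hg⟩⟩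
  have hn' : (5 : ℚ) ≤ n := by exact_mod_cast hn
  have hL' : (1 : ℚ) < L := by exact_mod_cast hL
  have hlc := H.adm.eps_mul
  have hsum := H.adm.lcs_add_lcp_add_eps_le
  have hε := H.adm.eps_nonneg
  have hlcs : (0 : ℚ) ≤ S.lcsV := Nat.cast_nonneg _
  have hlcp : (0 : ℚ) ≤ S.lcpV := Nat.cast_nonneg _
  -- a repetition of length `c` in `g` suffices if `r + ε ≤ c * L`
  have hfin : ∀ q' c : ℕ, 0 < c → q' + k + c ≤ N → RepAt g q' k c →
      (s : ℚ) + m * L + t + ε ≤ c * L → RepBound n ε E (k * L) (s + m * L + t) := by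
    intro q' c hc hN hrep hle
    have h1 := (H.good q' k c hk hc hN hrep).mul_le hn hε
    have h2 : ((n - 1 : ℕ) : ℚ) * c ≤ k := by exact_mod_cast h1
    rw [Nat.cast_sub (by omega)] at h2
    push_cast at h2
    refine .of_le hn hε ?_
    push_cast
    calc ((n : ℚ) - 1) * (s + m * L + t + ε) ≤ ((n : ℚ) - 1) * (c * L) := by gcongr; linarith
      _ = (((n : ℚ) - 1) * c) * L := by ring
      _ ≤ k * L := by gcongr
  rcases hl with ⟨hs1, hs2⟩ | ⟨q₀, rfl, hg₀, hs1⟩ <;> rcases hrt with ⟨ht1, ht2⟩ | ⟨hN, hg₁, ht1⟩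
  · have hs1' : (s : ℚ) ≤ S.lcsV := by exact_mod_cast hs1
    have ht1' : (t : ℚ) ≤ S.lcpV := by exact_mod_cast ht1
    rcases Nat.eq_zero_or_pos m with rfl | hm
    · obtain ⟨hs0, ht0⟩ := hst rfl
      obtain ⟨q₀, rfl, hg₀⟩ := hs2 hs0
      obtain ⟨hN, hg₁⟩ := ht2 ht0
      have h1 := e4 q₀
      have h2 : s + t ≤ L := by
        have : (s : ℚ) + t ≤ L := by linarith
        exact_mod_cast this
      rw [Nat.zero_mul, Nat.add_zero] at h ⊢
      rw [show q₀ + 1 + 0 + k = q₀ + k + 1 by omega, Nat.add_zero] at hg₁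
      exact H.repBound_cut_eq hk (by omega) hs0 ht0 hs.le ht.le (by omega) (by omega) rfl hg₀ hg₁ h
    -- Here s + t + ε ≤ ε(L - 1) + ε = εL, so r + ε ≤ (m + ε)L; this is the exact role of ε(L - 1) =
    -- lcs + lcp.
    · have h1 := H.mul_le_of_repAt hk hm (by omega) hmid
      refine .of_le hn hε ?_
      push_cast
      calc ((n : ℚ) - 1) * (s + m * L + t + ε) ≤ ((n : ℚ) - 1) * ((m + ε) * L) := by
            gcongr
            · linarith
            · linarith
        _ = (((n : ℚ) - 1) * (m + ε)) * L := by ring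
        _ ≤ k * L := by gcongr
  -- One matching end lengthens the preimage repetition by one letter, and s + t + ε ≤ lcs + (L -
  -- lcs - ε) + ε = L.
  · refine hfin q (m + 1) (by omega) (by omega) (fun j hj => ?_) ?_
    · rcases Nat.lt_succ_iff_lt_or_eq.1 hj with hj | rfl
      exacts [hmidg j hj, hg₁]
    · have hs1' : (s : ℚ) ≤ S.lcsV := by exact_mod_cast hs1
      push_cast; linarith
  · refine hfin q₀ (m + 1) (by omega) (by omega) (fun j hj => ?_) ?_
    · rcases j with _ | j
      · exact hg₀
      · have := hmidg j (by omega)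
        rwa [show q₀ + 1 + j = q₀ + (j + 1) by omega] at this
    · have ht1' : (t : ℚ) ≤ S.lcpV := by exact_mod_cast ht1
      push_cast; linarith
  -- Both ends match: s + t + ε ≤ 2L - lcs - lcp - ε ≤ 2L.
  · refine hfin q₀ (m + 2) (by omega) (by omega) (fun j hj => ?_) ?_
    · rcases j with _ | j
      · exact hg₀
      · rw [show q₀ + (j + 1) = q₀ + 1 + j by omega]
        rcases Nat.lt_succ_iff_lt_or_eq.1 (show j < m + 1 by omega) with hj | rfl
        exacts [hmidg j hj, hg₁]
    · push_cast; linarith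

/-- The image of an `(ε, E)`-threshold word is an `(ε, E)`-threshold word. -/
theorem good_image (H : S.IsImage ε E g ψ f N) : Good ε E f (N * L) := by
  have hn := H.adm.five_le
  have hε := H.adm.eps_nonneg
  intro i p r hp hr hi h
  -- Induction on the room left for r: an extendable repetition inherits its bound from the longer
  -- one, so the multiple-of-L case may assume maximality.
  induction hd : N * L - r using Nat.strong_induction_on generalizing i r with
  | _ d ih =>
  by_cases hdvd : L ∣ p
  · obtain ⟨k, rfl⟩ : ∃ k, p = k * L := exists_eq_mul_left_of_dvd hdvd
    have hk : 0 < k := Nat.pos_of_ne_zero (by rintro rfl; simp at hp)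
    by_cases hleft : 0 < i ∧ f (i - 1) = f (i - 1 + k * L)
    · refine .of_succ hn hε H.adm.eps_le_one
        (ih (N * L - (r + 1)) (by omega) (i - 1) (r + 1) (by omega) (by omega) ?_ rfl)
      intro t ht
      rcases t with _ | t
      · exact hleft.2
      · have := h t (by omega)
        rwa [show i - 1 + (t + 1) = i + t by omega]
    by_cases hright : i + k * L + r < N * L ∧ f (i + r) = f (i + r + k * L)
    · refine .of_succ hn hε H.adm.eps_le_one
        (ih (N * L - (r + 1)) (by omega) i (r + 1) (by omega) (by omega) ?_ rfl)
      intro t ht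
      rcases Nat.lt_succ_iff_lt_or_eq.1 ht with ht | rfl
      exacts [h t ht, hright.2]
    exact H.repBound_of_dvd hr hk hi h (fun h0 he => hleft ⟨h0, he⟩) fun h0 he => hright ⟨h0, he⟩
  · rcases Nat.lt_or_ge p r with hlt | hle
    -- Overlapping occurrences would contain a square with root p, whose bound (n - 1)p ≤ p is
    -- absurd.
    · have h1 := (H.repBound_of_not_dvd hp le_rfl (by omega) hdvd (h.mono hlt.le)).mul_le hn hε
      have h2 := Nat.mul_le_mul_right p (show 2 ≤ n - 1 by omega)
      omega
    · exact H.repBound_of_not_dvd hr hle hi hdvd h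

end IsImage

/-! ### Critical repetitions and the available images -/

/-- A repetition with repeated part of length `r` and root of length `p` ends at position `j` of `g`,
and its repeated parts must get different images. -/
structure IsCritical (ε : ℚ) (E : Set ℕ) (g : ℕ → Fin n) (j r p : ℕ) : Prop where
  root_pos : 0 < p
  pos : 0 < r
  mem : r ∈ E
  le : p + r ≤ j + 1
  repAt : RepAt g (j + 1 - p - r) p r
  lt : ¬ ((n : ℚ) - 1) * (r + ε) ≤ p

/-- Two roots p < p' for the same final factor of length r give a third repetition with root p' - p.
Both p and p' - p are at least (n - 1)r, so p' ≥ 2(n - 1)r ≥ (n - 1)(r + ε), and the longer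
repetition is not critical. -/
theorem IsCritical.not_lt (hn : 5 ≤ n) (hε : 0 ≤ ε) (hε1 : ε ≤ 1) {g : ℕ → Fin n}
    {N j r p p' : ℕ} (hg : Good ε E g N) (hj : j < N) (h : IsCritical ε E g j r p)
    (h' : IsCritical ε E g j r p') : ¬ p < p' := fun hlt => by
  have hr := h.pos
  have hle := h'.le
  have hle' := h.le
  have h1 := (hg _ p r h.root_pos hr (by omega) h.repAt).mul_le hn hε
  have h2 := (hg (j + 1 - p' - r) (p' - p) r (by omega) hr (by omega) ?_).mul_le hn hε
  · have h3 : ((n - 1 : ℕ) : ℚ) * r + ((n - 1 : ℕ) : ℚ) * r ≤ p' := by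
      exact_mod_cast (by omega : (n - 1) * r + (n - 1) * r ≤ p')
    rw [Nat.cast_sub (by omega)] at h3
    push_cast at h3
    apply h'.lt
    have h4 : (1 : ℚ) ≤ r := by exact_mod_cast hr
    have h5 : (5 : ℚ) ≤ n := by exact_mod_cast hn
    nlinarith
  · intro t ht
    rw [h'.repAt t ht, show j + 1 - p' - r + t + (p' - p) = j + 1 - p - r + t by omega,
      h.repAt t ht]
    congr 1; omega

theorem IsCritical.unique (hn : 5 ≤ n) (hε : 0 ≤ ε) (hε1 : ε ≤ 1) {g : ℕ → Fin n}
    {N j r p p' : ℕ} (hg : Good ε E g N) (hj : j < N) (h : IsCritical ε E g j r p)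
    (h' : IsCritical ε E g j r p') : p = p' :=
  le_antisymm (Nat.le_of_not_lt (h'.not_lt hn hε hε1 hg hj h))
    (Nat.le_of_not_lt (h.not_lt hn hε hε1 hg hj h'))

variable (S) in
/-- The images allowed at position `j` of `g` by the images of the neighbouring letters. -/
def following (g : ℕ → Fin n) (j : ℕ) (h : ℕ → List (Fin n)) : Finset (List (Fin n)) :=
  if j = 0 then S.V (g 0) else S.δ (g j) (h (j - 1))

open Classical in
variable (S ε E) in
/-- The images that may be chosen at position `j` of `g` after the images `h 0, …, h (j - 1)`. -/
noncomputable def options (g : ℕ → Fin n) (j : ℕ) (h : ℕ → List (Fin n)) :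
    Finset (List (Fin n)) :=
  (S.following g j h).filter fun v => ∀ r p, IsCritical ε E g j r p → v ≠ h (j - p)

/-- For each length r the critical root is unique, so r forbids at most one image. -/
theorem card_following_le (A : S.Admissible ε E) {g : ℕ → Fin n} {N j : ℕ} (hg : Good ε E g N)
    (hj : j < N) (h : ℕ → List (Fin n)) {R : Finset ℕ}
    (hR : ∀ r p, IsCritical ε E g j r p → r ∈ R) :
    (S.following g j h).card ≤ (S.options ε E g j h).card + R.card := by
  classical
  have hP : ∀ r, ∃ p, ∀ p', IsCritical ε E g j r p' → p' = p := fun r => by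
    by_cases hr : ∃ p, IsCritical ε E g j r p
    · obtain ⟨p, hp⟩ := hr
      exact ⟨p, fun p' hp' => hp'.unique A.five_le A.eps_nonneg A.eps_le_one hg hj hp⟩
    · exact ⟨0, fun p' hp' => absurd ⟨p', hp'⟩ hr⟩
  choose P hP using hP
  have hsub : S.following g j h ⊆ S.options ε E g j h ∪ R.image fun r => h (j - P r) := by
    intro v hv
    by_cases hvo : v ∈ S.options ε E g j h
    · exact Finset.mem_union_left _ hvo
    · refine Finset.mem_union_right _ (Finset.mem_image.2 ?_)
      simp only [options, Finset.mem_filter, hv, true_and, not_forall, not_not] at hvo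
      obtain ⟨r, p, hc, rfl⟩ := hvo
      exact ⟨r, hR r p hc, by rw [hP r p hc]⟩
  calc _ ≤ _ := Finset.card_le_card hsub
    _ ≤ _ := Finset.card_union_le _ _
    _ ≤ _ := Nat.add_le_add_left Finset.card_image_le _

theorem deltaMin_le {a b : Fin n} (hab : a ≠ b) {v : List (Fin n)} (hv : v ∈ S.V a) :
    S.deltaMin ≤ (S.δ b v).card :=
  Nat.sInf_le ⟨a, b, hab, v, hv, rfl⟩

theorem deltaMin_le_card_options_add (A : S.Admissible ε E) {g : ℕ → Fin n} {N j : ℕ} (hg : Good ε E g N)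
    (hj : j + 1 < N) {h : ℕ → List (Fin n)} (hh : h j ∈ S.V (g j)) {R : Finset ℕ}
    (hR : ∀ r p, IsCritical ε E g (j + 1) r p → r ∈ R) :
    S.deltaMin ≤ (S.options ε E g (j + 1) h).card + R.card := by
  refine le_trans ?_ (card_following_le A hg hj h hR)
  have hne : g j ≠ g (j + 1) := fun he => by
    have h1 := hg.dist A.five_le A.eps_nonneg (Nat.lt_succ_self j) hj he
    have h2 := A.five_le
    omega
  simpa [following] using deltaMin_le hne hh

theorem options_nonempty (A : S.Admissible ε E) (hδ : E.encard < (S.deltaMin : ℕ∞))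
    {g : ℕ → Fin n} {N : ℕ} (hg : Good ε E g (N + 1)) {h : ℕ → List (Fin n)}
    (hh : S.IsSubst ε E g h N) : 0 < (S.options ε E g N h).card := by
  have hfin : E.Finite := Set.finite_of_encard_le_coe hδ.le
  rcases N with _ | j
  · have h1 := card_following_le A hg one_pos h (R := ∅) fun r p hc => by
      have := hc.le; have := hc.pos; have := hc.root_pos; omega
    have h2 := (S.V_nonempty (g 0)).card_pos
    simp only [following, if_true, Finset.card_empty] at h1
    omega
  · have h1 := deltaMin_le_card_options_add A hg (by omega) (hh.mem j (by omega))
      (R := hfin.toFinset) fun r p hc => hfin.mem_toFinset.2 hc.mem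
    rw [hfin.encard_eq_coe_toFinset_card] at hδ
    have h2 : hfin.toFinset.card < S.deltaMin := by exact_mod_cast hδ
    omega

theorem two_le_card_options (A : S.Admissible ε E) (hδ : E.encard < (S.deltaMin : ℕ∞))
    (h1E : 1 ∈ E) {g : ℕ → Fin n} {j : ℕ} (hg : Good ε E g (j + 2)) {h : ℕ → List (Fin n)}
    (hh : S.IsSubst ε E g h (j + 1)) (hcrit : ∀ p, ¬ IsCritical ε E g (j + 1) 1 p) :
    2 ≤ (S.options ε E g (j + 1) h).card := by
  have hfin : E.Finite := Set.finite_of_encard_le_coe hδ.le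
  have h1 := deltaMin_le_card_options_add A hg (by omega) (hh.mem j (by omega))
    (R := hfin.toFinset.erase 1) fun r p hc => Finset.mem_erase.2
      ⟨by rintro rfl; exact hcrit p hc, hfin.mem_toFinset.2 hc.mem⟩
  rw [hfin.encard_eq_coe_toFinset_card] at hδ
  have h2 : hfin.toFinset.card < S.deltaMin := by exact_mod_cast hδ
  have h3 := Finset.card_erase_add_one (hfin.mem_toFinset.2 h1E)
  omega

/-- A critical repetition ending at the new letter is split at its last pair of letters, which is
what `options` enforces; the others were split before. -/
theorem IsSubst.update {g : ℕ → Fin n} {h : ℕ → List (Fin n)} {N : ℕ}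
    (hg : Good ε E g (N + 1)) (hn : 5 ≤ n) (hε : 0 ≤ ε)
    (hh : S.IsSubst ε E g h N) {v : List (Fin n)} (hv : v ∈ S.options ε E g N h) :
    S.IsSubst ε E g (Function.update h N v) (N + 1) := by
  classical
  obtain ⟨hv1, hv2⟩ := Finset.mem_filter.1 hv
  have hold : ∀ q, q < N → Function.update h N v q = h q := fun q hq =>
    Function.update_of_ne (by omega) _ _
  have hnew : Function.update h N v N = v := Function.update_self _ _ _
  refine ⟨fun q hq => ?_, fun q hq => ?_, fun i p r hp hr hi hrep hrE hlt => ?_⟩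
  · rcases Nat.lt_succ_iff_lt_or_eq.1 hq with hq | rfl
    · rw [hold q hq]; exact hh.mem q hq
    · rw [hnew]
      rcases q with _ | j
      · simpa [following] using hv1
      · have hne : g j ≠ g (j + 1) := fun he => by
          have h1 := hg.dist hn hε (Nat.lt_succ_self j) (by omega) he
          omega
        exact S.δ_subset _ _ hne _ (hh.mem j (by omega)) (by simpa [following] using hv1)
  · rcases Nat.lt_succ_iff_lt_or_eq.1 hq with hq | rfl
    · rw [hold _ hq, hold q (by omega)]; exact hh.follows q hq
    · rw [hnew, hold q (by omega)]
      simpa [following] using hv1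
  · rcases Nat.lt_succ_iff_lt_or_eq.1 (Nat.lt_succ_of_le hi) with hi | hi
    · obtain ⟨m, hm, hne⟩ := hh.splits i p r hp hr (by omega) hrep hrE hlt
      exact ⟨m, hm, by rwa [hold _ (by omega), hold _ (by omega)]⟩
    · refine ⟨r - 1, by omega, ?_⟩
      rw [show i + (r - 1) + p = N by omega, hnew, hold _ (by omega),
        show i + (r - 1) = N - p by omega]
      refine (hv2 r p ⟨hp, hr, hrE, by omega, ?_, hlt⟩).symm
      rwa [show N + 1 - p - r = i by omega]

/-! ### Counting substitutions -/

open Classical in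
variable (S ε E) in
/-- Substitutions on the first `N` letters of `g`, built from left to right. -/
noncomputable def substs (g : ℕ → Fin n) : ℕ → Finset (ℕ → List (Fin n))
  | 0 => {fun _ => []}
  | N + 1 => (substs g N).biUnion fun h => (S.options ε E g N h).image (Function.update h N)

theorem isSubst_of_mem_substs (hn : 5 ≤ n) (hε : 0 ≤ ε) {g : ℕ → Fin n} {N : ℕ}
    (hg : Good ε E g N) {ψ : ℕ → List (Fin n)} (hψ : ψ ∈ S.substs ε E g N) :
    S.IsSubst ε E g ψ N ∧ ∀ q, N ≤ q → ψ q = [] := by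
  induction N generalizing ψ with
  | zero =>
    obtain rfl := Finset.mem_singleton.1 hψ
    exact ⟨⟨fun q hq => by omega, fun q hq => by omega, fun i p r hp hr hi => by omega⟩,
      fun q _ => rfl⟩
  | succ N ih =>
    simp only [substs, Finset.mem_biUnion, Finset.mem_image] at hψ
    obtain ⟨h, hh, v, hv, rfl⟩ := hψ
    obtain ⟨h1, h2⟩ := ih (hg.mono (by omega)) hh
    refine ⟨h1.update hg hn hε hv, fun q hq => ?_⟩
    rw [Function.update_of_ne (by omega)]
    exact h2 q (by omega)

/-- Extensions of different partial substitutions stay different, because all of them take the value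
`[]` at N before the update. -/
theorem mul_card_substs_le (hn : 5 ≤ n) (hε : 0 ≤ ε) {g : ℕ → Fin n} {N c : ℕ}
    (hg : Good ε E g N) (hc : ∀ h ∈ S.substs ε E g N, c ≤ (S.options ε E g N h).card) :
    c * (S.substs ε E g N).card ≤ (S.substs ε E g (N + 1)).card := by
  classical
  rw [substs, Finset.card_biUnion, Nat.mul_comm, ← smul_eq_mul]
  · refine Finset.card_nsmul_le_sum _ _ _ fun h hh => ?_
    rw [Finset.card_image_of_injective _ (Function.update_injective h N)]
    exact hc h hh
  · intro h hh h' hh' hne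
    rw [Function.onFun, Finset.disjoint_left]
    intro ψ hψ hψ'
    obtain ⟨v, -, rfl⟩ := Finset.mem_image.1 hψ
    obtain ⟨v', -, he⟩ := Finset.mem_image.1 hψ'
    apply hne
    funext q
    have h1 := (isSubst_of_mem_substs hn hε hg hh).2
    have h2 := (isSubst_of_mem_substs hn hε hg hh').2
    have h3 := congrFun he q
    rcases eq_or_ne q N with rfl | hq
    · rw [h1 q le_rfl, h2 q le_rfl]
    · rw [Function.update_of_ne hq, Function.update_of_ne hq] at h3
      exact h3.symm

theorem card_substs_le_succ (A : S.Admissible ε E) (hδ : E.encard < (S.deltaMin : ℕ∞))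
    {g : ℕ → Fin n} {N : ℕ} (hg : Good ε E g (N + 1)) :
    (S.substs ε E g N).card ≤ (S.substs ε E g (N + 1)).card := by
  have := mul_card_substs_le A.five_le A.eps_nonneg (c := 1) (hg.mono (Nat.le_succ N))
    fun h hh => options_nonempty A hδ hg
      (isSubst_of_mem_substs A.five_le A.eps_nonneg (hg.mono (Nat.le_succ N)) hh).1
  simpa using this

theorem substs_nonempty (A : S.Admissible ε E) (hδ : E.encard < (S.deltaMin : ℕ∞))
    {g : ℕ → Fin n} {N : ℕ} (hg : Good ε E g N) : 0 < (S.substs ε E g N).card := by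
  induction N with
  | zero => simp [substs]
  | succ N ih => exact (ih (hg.mono (Nat.le_succ N))).trans_le (card_substs_le_succ A hδ hg)

/-! ### Existence of long and infinite words -/

/-- The infinite word whose factors of length `L` at the multiples of `L` are the words `ψ q`. -/
def blockWord (hn : 0 < n) (L : ℕ) (ψ : ℕ → List (Fin n)) (i : ℕ) : Fin n :=
  (ψ (i / L)).getD (i % L) ⟨0, hn⟩

theorem seg_blockWord (hn : 0 < n) {ψ : ℕ → List (Fin n)} {q : ℕ} (hL : (ψ q).length = L) :
    ψ q = seg (blockWord hn L ψ) (q * L) L := by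
  apply List.ext_getElem?
  intro j
  by_cases hj : j < L
  · rw [getElem?_seg _ hj, blockWord, Nat.mul_comm, Nat.mul_add_div (by omega),
      Nat.div_eq_of_lt hj, Nat.mul_add_mod, Nat.mod_eq_of_lt hj, Nat.add_zero,
      List.getD_eq_getElem?_getD, List.getElem?_eq_getElem (by omega)]
    rfl
  · rw [List.getElem?_eq_none (by omega), List.getElem?_eq_none (by simp; omega)]

theorem isImage_blockWord (A : S.Admissible ε E) (hn : 0 < n) {g : ℕ → Fin n} {N : ℕ}
    (hg : Good ε E g N) {ψ : ℕ → List (Fin n)} (hψ : S.IsSubst ε E g ψ N) :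
    S.IsImage ε E g ψ (blockWord hn L ψ) N :=
  ⟨A, hg, hψ, fun q hq => seg_blockWord hn (S.V_length _ _ (hψ.mem q hq))⟩

/-- One substitution turns N ≥ 1 good letters into NL ≥ N + 1. -/
theorem exists_good (A : S.Admissible ε E) (hδ : E.encard < (S.deltaMin : ℕ∞)) (N : ℕ) :
    ∃ g : ℕ → Fin n, Good ε E g N := by
  have hn : 0 < n := by have := A.five_le; omega
  have hL := A.one_lt
  induction N with
  | zero => exact ⟨fun _ => ⟨0, hn⟩, fun i p r hp hr hi => by omega⟩
  | succ N ih =>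
    obtain ⟨g, hg⟩ := ih
    rcases Nat.eq_zero_or_pos N with rfl | hN
    · exact ⟨g, fun i p r hp hr hi => by omega⟩
    obtain ⟨ψ, hψ⟩ := Finset.card_pos.1 (substs_nonempty A hδ hg)
    have hI := isImage_blockWord A hn hg (isSubst_of_mem_substs A.five_le A.eps_nonneg hg hψ).1
    refine ⟨_, hI.good_image.mono ?_⟩
    have := Nat.mul_le_mul_left N hL
    omega

/-- Compactness of the space of infinite words: being good up to N depends on finitely many letters,
so these sets are closed, nested and nonempty. -/
theorem exists_good_forall (A : S.Admissible ε E) (hδ : E.encard < (S.deltaMin : ℕ∞)) :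
    ∃ f : ℕ → Fin n, ∀ N, Good ε E f N := by
  have hclosed : ∀ N, IsClosed {f : ℕ → Fin n | Good ε E f N} := fun N => by
    simp only [Good, Set.ofPred_forall]
    refine isClosed_iInter fun i => isClosed_iInter fun p => isClosed_iInter fun r =>
      isClosed_iInter fun _ => isClosed_iInter fun _ => isClosed_iInter fun _ => ?_
    refine isClosed_imp ?_ isClosed_const
    have : {f : ℕ → Fin n | RepAt f i p r} =
        ⋂ t ∈ Set.Iio r, {f : ℕ → Fin n | f (i + t) = f (i + t + p)} := by
      ext f; simp [RepAt]
    rw [this]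
    refine (Set.finite_Iio r).isOpen_biInter fun t _ => ?_
    have hc : Continuous fun f : ℕ → Fin n => (f (i + t), f (i + t + p)) := by fun_prop
    exact (isOpen_discrete {x : Fin n × Fin n | x.1 = x.2}).preimage hc
  obtain ⟨f, hf⟩ := IsCompact.nonempty_iInter_of_sequence_nonempty_isCompact_isClosed
    (fun N => {f : ℕ → Fin n | Good ε E f N}) (fun N f hf => Good.mono hf (Nat.le_succ N))
    (exists_good A hδ) (hclosed 0).isCompact hclosed
  exact ⟨f, fun N => Set.mem_iInter.1 hf N⟩

/-! ### Exponential growth -/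

theorem one_mem (A : S.Admissible ε E) (hδ : E.encard < (S.deltaMin : ℕ∞)) : 1 ∈ E := by
  by_contra h1
  have hn := A.five_le
  have hn' : (5 : ℚ) ≤ n := by exact_mod_cast hn
  obtain ⟨g, hg⟩ := exists_good_forall A hδ
  -- If 1 is not in E, equal letters need a distance of at least (n - 1)(1 + ε), which exceeds n - 1
  -- because ε > 0.
  have hdist : ∀ i p, 0 < p → p < n → g i ≠ g (i + p) := fun i p hp hpn he => by
    have h2 := hg (i + p + 1) i p 1 hp one_pos le_rfl fun t ht => by
      obtain rfl : t = 0 := by omega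
      exact he
    rw [RepBound, chi_of_notMem h1] at h2
    have h3 : (p : ℚ) + 1 ≤ n := by exact_mod_cast hpn
    have := A.eps_pos
    push_cast at h2
    nlinarith
  -- Any n consecutive letters are distinct and exhaust the alphabet, so the word has period n;
  -- already two repeated letters would need a root of length 2(n - 1) > n.
  have hper : ∀ i, g i = g (i + n) := fun i => by
    have hinj : Function.Injective fun j : Fin n => g (i + j) := fun j k hjk => by
      by_contra hne
      rcases Nat.lt_or_gt_of_ne (Fin.val_ne_of_ne hne) with hlt | hlt
      · refine hdist (i + j) (k - j) (by omega) (by omega) ?_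
        rw [show i + (j : ℕ) + (k - j) = i + k by omega]; exact hjk
      · refine hdist (i + k) (j - k) (by omega) (by omega) ?_
        rw [show i + (k : ℕ) + (j - k) = i + j by omega]; exact hjk.symm
    obtain ⟨j, hj⟩ := (Finite.injective_iff_surjective.1 hinj) (g (i + n))
    rcases Nat.eq_zero_or_pos j with h0 | h0
    · simpa [h0] using hj
    · refine absurd hj (?_ : g (i + j) ≠ g (i + n))
      have := hdist (i + j) (n - j) (by omega) (by omega)
      rwa [show i + (j : ℕ) + (n - j) = i + n by omega] at this
  have := (hg (n + 2) 0 n 2 (by omega) two_pos (by omega) fun t _ => hper _).mul_le hn A.eps_nonneg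
  omega

/-- The images of one of two consecutive letters can be chosen in two ways. -/
theorem two_mul_card_substs_le (A : S.Admissible ε E) (hδ : E.encard < (S.deltaMin : ℕ∞))
    (hε : ε ≤ 1 / ((n : ℚ) - 1)) {g : ℕ → Fin n} {j : ℕ} (hg : Good ε E g (j + 3)) :
    2 * (S.substs ε E g (j + 1)).card ≤ (S.substs ε E g (j + 3)).card := by
  have hn := A.five_le
  have hn' : (5 : ℚ) ≤ n := by exact_mod_cast hn
  have hdouble : ∀ i ≤ j + 1, (∀ p, ¬ IsCritical ε E g (i + 1) 1 p) →
      2 * (S.substs ε E g (i + 1)).card ≤ (S.substs ε E g (i + 2)).card := fun i hi hcrit =>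
    mul_card_substs_le hn A.eps_nonneg (hg.mono (by omega)) fun h hh =>
      two_le_card_options A hδ (one_mem A hδ) (hg.mono (by omega))
        (isSubst_of_mem_substs hn A.eps_nonneg (hg.mono (by omega)) hh).1 hcrit
  -- By ε ≤ 1/(n - 1), criticality gives p < (n - 1)(1 + ε) ≤ n, while goodness gives p ≥ n - 1.
  have hroot : ∀ i p, i < j + 3 → IsCritical ε E g i 1 p → p = n - 1 := fun i p hi hc => by
    have h1 := hc.le
    have h2 := (hg _ p 1 hc.root_pos one_pos (by omega) hc.repAt).mul_le hn A.eps_nonneg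
    have h3 := hc.lt
    rw [le_div_iff₀ (by linarith)] at hε
    have h4 : (p : ℚ) < n := by push_cast at h3; nlinarith
    have h5 : p < n := by exact_mod_cast h4
    omega
  by_cases h1 : ∃ p, IsCritical ε E g (j + 1) 1 p
  · refine (Nat.mul_le_mul_left 2 (card_substs_le_succ A hδ (hg.mono (by omega)))).trans
      (hdouble (j + 1) le_rfl fun p' h2 => ?_)
    obtain ⟨p, h1⟩ := h1
    obtain rfl := hroot _ _ (by omega) h1
    obtain rfl := hroot _ _ (by omega) h2
    have hle := h1.le
    -- Consecutive critical letters with root n - 1 combine into a repeated part of length 2 with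
    -- that root, which is too short.
    have h3 := (hg (j + 1 + 1 - (n - 1) - 1) (n - 1) 2 (by omega) two_pos (by omega)
      ?_).mul_le hn A.eps_nonneg
    · omega
    · intro t ht
      rcases t with _ | t
      · exact h1.repAt 0 one_pos
      · obtain rfl : t = 0 := by omega
        have := h2.repAt 0 one_pos
        rwa [show j + 1 + 1 + 1 - (n - 1) - 1 + 0 = j + 1 + 1 - (n - 1) - 1 + (0 + 1) by omega]
          at this
  · exact (hdouble j (by omega) fun p hp => h1 ⟨p, hp⟩).trans (card_substs_le_succ A hδ hg)

theorem two_pow_le_card_substs (A : S.Admissible ε E) (hδ : E.encard < (S.deltaMin : ℕ∞))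
    (hε : ε ≤ 1 / ((n : ℚ) - 1)) {g : ℕ → Fin n} {k : ℕ} (hg : Good ε E g (2 * k + 1)) :
    2 ^ k ≤ (S.substs ε E g (2 * k + 1)).card := by
  induction k with
  | zero => exact substs_nonempty A hδ hg
  | succ k ih =>
    have h1 := two_mul_card_substs_le A hδ hε (j := 2 * k) hg
    have h2 := ih (hg.mono (by omega))
    rw [pow_succ]
    exact (by omega : 2 ^ k * 2 ≤ 2 * (S.substs ε E g (2 * k + 1)).card).trans h1

/-- All images have length L, so a substitution can be read off its result block by block; beyond N
it is constantly `[]`. -/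
theorem card_substs_le_thresholdCount (A : S.Admissible ε E) {g : ℕ → Fin n} {N : ℕ}
    (hg : Good ε E g N) : (S.substs ε E g N).card ≤ thresholdCount n (N * L) := by
  have hn : 0 < n := by have := A.five_le; omega
  have hsub := fun ψ (hψ : ψ ∈ S.substs ε E g N) => isSubst_of_mem_substs A.five_le A.eps_nonneg hg hψ
  have hfin : {w : List (Fin n) | w.length = N * L ∧ IsThreshold w}.Finite :=
    (List.finite_length_eq (Fin n) (N * L)).subset fun w hw => hw.1
  rw [thresholdCount, ← Set.ncard_coe_finset]
  refine Set.ncard_le_ncard_of_injOn (fun ψ => seg (blockWord hn L ψ) 0 (N * L)) ?_ ?_ hfin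
  · intro ψ hψ
    exact ⟨length_seg _ _ _, (isImage_blockWord A hn hg (hsub ψ hψ).1).good_image.isThreshold
      A.five_le A.eps_nonneg (by omega)⟩
  · intro ψ hψ ψ' hψ' he
    funext q
    rcases Nat.lt_or_ge q N with hq | hq
    · rw [(isImage_blockWord A hn hg (hsub ψ hψ).1).eq_seg q hq,
        (isImage_blockWord A hn hg (hsub ψ' hψ').1).eq_seg q hq]
      refine seg_congr fun t ht => ?_
      have h1 := Nat.mul_le_mul_right L (Nat.succ_le_of_lt hq)
      rw [Nat.succ_mul] at h1
      have := ThresholdWords.eq_of_seg_eq he (t := q * L + t) (by omega)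
      simpa using this
    · rw [(hsub ψ hψ).2 q hq, (hsub ψ' hψ').2 q hq]

end ImageSystem

/-- Threshold words are closed under prefixes, and the remaining b letters have at most n ^ b
values. -/
theorem thresholdCount_add_le (n a b : ℕ) :
    thresholdCount n (a + b) ≤ thresholdCount n a * n ^ b := by
  have hcard : {w : List (Fin n) | w.length = b}.ncard = n ^ b := by
    rw [← Nat.card_coe_set_eq]
    change Nat.card (List.Vector (Fin n) b) = n ^ b
    rw [Nat.card_eq_fintype_card, card_vector, Fintype.card_fin]
  have hfin : {w : List (Fin n) | w.length = a ∧ IsThreshold w}.Finite :=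
    (List.finite_length_eq (Fin n) a).subset fun w hw => hw.1
  rw [thresholdCount, thresholdCount, ← hcard, ← Set.ncard_prod]
  refine Set.ncard_le_ncard_of_injOn (fun w => (w.take a, w.drop a)) ?_ ?_
    (hfin.prod (List.finite_length_eq (Fin n) b))
  · rintro w ⟨hw, hT⟩
    exact ⟨⟨by simp [hw], fun v hv hvw => hT v hv (hvw.trans (List.take_prefix a w).isInfix)⟩,
      by simp [hw]⟩
  · intro w _ w' _ he
    obtain ⟨h1, h2⟩ := Prod.mk.inj he
    rw [← List.take_append_drop a w, ← List.take_append_drop a w', h1, h2]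

end ThresholdWords

open ThresholdWords in
theorem mainTheorem3 (n L : ℕ) (hn : 5 ≤ n) (hL : 1 < L) (ε : ℚ) (hε : 0 ≤ ε) (E : Set ℕ)
    (S : ThresholdWords.ImageSystem n L) (hS : S.Consistent ε E)
    (hlc : ε * ((L : ℚ) - 1) = (S.lcsV : ℚ) + (S.lcpV : ℚ))
    (hδ : E.encard < (S.deltaMin : ℕ∞)) :
    (∃ f : ℕ → Fin n, ThresholdWords.IsInfiniteThreshold f) ∧
    (ε ≤ 1 / ((n : ℚ) - 1) →
      ∃ C γ : ℝ, 0 < C ∧ 1 < γ ∧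
        ∀ m : ℕ, C * γ ^ m ≤ (ThresholdWords.thresholdCount n m : ℝ)) := by
  have A : S.Admissible ε E := ⟨hn, hL, hε, hS, hlc⟩
  refine ⟨?_, fun hε1 => ?_⟩
  · obtain ⟨f, hf⟩ := ImageSystem.exists_good_forall A hδ
    exact ⟨f, fun i k => (hf (i + k)).isThreshold hn hε le_rfl⟩
  · have hL0 : (0 : ℝ) < 2 * L := by positivity
    have hn0 : (0 : ℝ) < n := by positivity
    have hn1 : (1 : ℝ) ≤ n := by exact_mod_cast (by omega : 1 ≤ n)
    -- The count doubles for every 2L letters of the image, whence γ. The constant absorbs the at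
    -- most 3L letters cut off to reach length m.
    refine ⟨1 / (n : ℝ) ^ (3 * L), 2 ^ (1 / (2 * L : ℝ)), by positivity,
      Real.one_lt_rpow one_lt_two (by positivity), fun m => ?_⟩
    set k := m / (2 * L) + 1 with hk
    have hdm := Nat.div_add_mod' m (2 * L)
    have hml := Nat.mod_lt m (show 0 < 2 * L by omega)
    have e1 : (2 * k + 1) * L = m / (2 * L) * (2 * L) + 3 * L := by rw [hk]; ring
    obtain ⟨b, hb⟩ : ∃ b, (2 * k + 1) * L = m + b := ⟨(2 * k + 1) * L - m, by omega⟩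
    have hb3 : b ≤ 3 * L := by omega
    obtain ⟨g, hg⟩ := ImageSystem.exists_good A hδ (2 * k + 1)
    have h1 := (ImageSystem.two_pow_le_card_substs A hδ hε1 hg).trans
      (ImageSystem.card_substs_le_thresholdCount A hg)
    rw [hb] at h1
    have h2 : (2 : ℝ) ^ k ≤ thresholdCount n m * (n : ℝ) ^ b := by
      exact_mod_cast h1.trans (thresholdCount_add_le n m b)
    have h3 : ((2 : ℝ) ^ (1 / (2 * L : ℝ))) ^ m ≤ 2 ^ k := by
      rw [← Real.rpow_natCast, ← Real.rpow_mul (by norm_num), ← Real.rpow_natCast 2 k]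
      refine Real.rpow_le_rpow_of_exponent_le one_le_two ?_
      rw [one_div_mul_eq_div, div_le_iff₀ hL0]
      have h4 : m ≤ k * (2 * L) := by rw [hk, Nat.add_mul]; omega
      exact_mod_cast h4
    rw [one_div_mul_eq_div, div_le_iff₀ (by positivity)]
    calc _ ≤ _ := h3
      _ ≤ _ := h2
      _ ≤ _ := by gcongr
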